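/- Let $k$ be a field of characteristic zero, $n\ge 1$ an integer, and $q=(q_1,q_2)\in(k^\times)^2$. Let $\overline{\Gamma}_n$ be the quiver with vertices $1,2$ and arrows $a_1,\dots,a_n:1\to 2$, $b_1,\dots,b_n:2\to 1$. Let $k\overline{\Gamma}_n$ be its path algebra, with vertex idempotents $e_1,e_2$, $e_1+e_2=1$, $a_i=e_2a_ie_1$, $b_i=e_1b_ie_2$, and let $B=ke_1\oplus ke_2$. For an alternating sequence $y_1,\dots,y_m$ of letters from the sets $\{a_i\}$ and $\{b_i\}$, the Euler continuants are defined by $(y_1)=y_1$, $(y_1,y_2)=e+y_1y_2$, where $e=e_2$ if $y_1$ is one of the $a_i$ and $e=e_1$ otherwise, and $(y_1,\dots,y_m)=(y_1,\dots,y_{m-1})y_m+(y_1,\dots,y_{m-2})$ for $m\ge 3$. The Boalch algebra $\mathcal{B}(\Gamma_n)$ is obtained from $k\overline{\Gamma}_n$ by adjoining an inverse of $(a_1,b_1,\dots,a_n,b_n)$ in $e_2\mathcal{B}(\Gamma_n)e_2$ and an inverse of $(b_n,a_n,\dots,b_1,a_1)$ in $e_1\mathcal{B}(\Gamma_n)e_1$.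 The fission algebra $\mathcal{F}^q(\Gamma_n)$ is the quotient of $\mathcal{B}(\Gamma_n)$ by the two-sided ideal generated by $(b_n,a_n,\dots,b_1,a_1)^{-1}-q_1e_1$ and $(a_1,b_1,\dots,a_n,b_n)-q_2e_2$; let $\pi:\mathcal{B}(\Gamma_n)\to\mathcal{F}^q(\Gamma_n)$ be the projection. A $B$-linear double bracket on a $B$-algebra $A$ is a $k$-bilinear map $\{\!\{-,-\}\!\}:A\times A\to A\otimes_k A$ with $\{\!\{a,b\}\!\}=-\tau_{(12)}\{\!\{b,a\}\!\}$, where $\tau_{(12)}(x\otimes y)=y\otimes x$, with $\{\!\{a,bc\}\!\}=\{\!\{a,b\}\!\}(1\otimes c)+(b\otimes 1)\{\!\{a,c\}\!\}$, and with $\{\!\{-,e\}\!\}=0$ for $e\in B$. It is quasi-Poisson if for all $a,b,c\in A$ $$\begin{aligned} &\{\!\{a,\{\!\{b,c\}\!\}\}\!\}_L+\tau_{(123)}\{\!\{b,\{\!\{c,a\}\!\}\}\!\}_L+\tau_{(132)}\{\!\{c,\{\!\{a,b\}\!\}\}\!\}_L\\ &=\tfrac14\sum_{s=1,2}\big(ce_sa\otimes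 e_sb\otimes e_s-ce_sa\otimes e_s\otimes be_s-ce_s\otimes ae_sb\otimes e_s+ce_s\otimes ae_s\otimes be_s\\ &\qquad\quad-e_sa\otimes e_sb\otimes e_sc+e_sa\otimes e_s\otimes be_sc+e_s\otimes ae_sb\otimes e_sc-e_s\otimes ae_s\otimes be_sc\big), \end{aligned}$$ where $\{\!\{a,x\otimes y\}\!\}_L=\{\!\{a,x\}\!\}\otimes y$, $\tau_{(123)}(x\otimes y\otimes z)=z\otimes x\otimes y$ and $\tau_{(132)}=\tau_{(123)}^2$. Its associated bracket is $\{a,b\}=m(\{\!\{a,b\}\!\})$, where $m$ is the product of $A$. Put $H_0(A)=A/[A,A]$, where $[A,A]$ is the linear span of the commutators, and write $\overline{a}$ for the class of $a$. An $H_0$-Poisson structure on $A$ is a Lie bracket on $H_0(A)$ such that for every $x\in H_0(A)$ the map $\{x,-\}:H_0(A)\to H_0(A)$ is induced by a derivation $A\to A$. Then there is a unique $B$-linear double bracket on $\mathcal{B}(\Gamma_n)$ such that, for all $i,j\in\{1,\dots,n\}$, $$\{\!\{a_i,a_j\}\!\}=\tfrac12\operatorname{sgn}(i-j)(a_i\otimes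 a_j+a_j\otimes a_i),\qquad \{\!\{b_i,b_j\}\!\}=\tfrac12\operatorname{sgn}(i-j)(b_i\otimes b_j+b_j\otimes b_i),$$ $$\{\!\{a_i,b_j\}\!\}=\begin{cases}\tfrac12(e_1\otimes a_ib_j+b_ja_i\otimes e_2), & i<j,\\ \tfrac12(b_ia_i\otimes e_2+e_1\otimes a_ib_i)+e_1\otimes e_2, & i=j,\\ -\tfrac12(b_ja_i\otimes e_2+e_1\otimes a_ib_j)-\delta_{i-j,1}\,e_1\otimes e_2, & i>j,\end{cases}$$ and $\{\!\{b_i,a_j\}\!\}=-\tau_{(12)}\{\!\{a_j,b_i\}\!\}$. This double bracket is quasi-Poisson, and its associated bracket $\{-,-\}$ induces an $H_0$-Poisson structure on $\mathcal{F}^q(\Gamma_n)$: there is a unique $H_0$-Poisson structure $\{-,-\}_{H_0}$ on $\mathcal{F}^q(\Gamma_n)$ such that $$\{\overline{\pi(x)},\overline{\pi(y)}\}_{H_0}=\overline{\pi(\{x,y\})}\qquad\text{for all }x,y\in\mathcal{B}(\Gamma_n).$$ -/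

import Mathlib

open scoped TensorProduct

namespace NCPoisson

section General

variable (k : Type*) [Field k] (A : Type*) [Ring A] [Algebra k A]

/-- The subspace `[A, A]` spanned by all commutators. -/
def commutatorSubspace : Submodule k A :=
  Submodule.span k (Set.range fun p : A × A => p.1 * p.2 - p.2 * p.1)

/-- The zeroth Hochschild homology `H₀(A) = A / [A, A]`, as a vector space. -/
abbrev H0 : Type _ := A ⧸ commutatorSubspace k A

/-- The projection `A → H₀(A)`. -/
abbrev toH0 : A →ₗ[k] H0 k A := (commutatorSubspace k A).mkQ

/-- An `H₀`-Poisson structure on `A` (Crawley-Boevey): a Lie bracket on `H₀(A)` such that every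
map `{x, -}` on `H₀(A)` is induced by a `k`-linear derivation `A → A`. -/
structure H0PoissonStructure where
  bracket : H0 k A →ₗ[k] H0 k A →ₗ[k] H0 k A
  bracket_self : ∀ x, bracket x x = 0
  jacobi : ∀ x y z,
    bracket x (bracket y z) + bracket y (bracket z x) + bracket z (bracket x y) = 0
  exists_derivation : ∀ x : H0 k A, ∃ d : A →ₗ[k] A,
    (∀ a b, d (a * b) = d a * b + a * d b) ∧ ∀ a, bracket x (toH0 k A a) = toH0 k A (d a)

variable {A} {I : Type*}

/-- A double bracket on `A`, linear over the subalgebra `B = ⊕ₛ k eₛ` spanned by a family `e` of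
idempotents. In the algebra `A ⊗ A`, right multiplication by `1 ⊗ c` and left multiplication by
`b ⊗ 1` are the two actions of the outer bimodule structure. -/
structure DoubleBracket (e : I → A) where
  toFun : A →ₗ[k] A →ₗ[k] A ⊗[k] A
  antisymm : ∀ a b, toFun a b = -TensorProduct.comm k A A (toFun b a)
  leibniz : ∀ a b c, toFun a (b * c) = toFun a b * (1 ⊗ₜ[k] c) + (b ⊗ₜ[k] 1) * toFun a c
  map_idem : ∀ a s, toFun a (e s) = 0

namespace DoubleBracket

variable {k} {e : I → A} (D : DoubleBracket k e)

/-- The associated bracket `{a, b} = m(⦃a, b⦄)`, where `m` is the product of `A`. -/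
def assocBracket (a b : A) : A := LinearMap.mul' k A (D.toFun a b)

/-- The extension `⦃a, b ⊗ c⦄_L = ⦃a, b⦄ ⊗ c`. -/
def extL (a : A) : A ⊗[k] A →ₗ[k] (A ⊗[k] A) ⊗[k] A := (D.toFun a).rTensor A

end DoubleBracket

variable (A) in
/-- The cyclic permutation `a₁ ⊗ a₂ ⊗ a₃ ↦ a₃ ⊗ a₁ ⊗ a₂`. -/
def tau123 : (A ⊗[k] A) ⊗[k] A →ₗ[k] (A ⊗[k] A) ⊗[k] A :=
  (TensorProduct.assoc k A A A).symm.toLinearMap ∘ₗ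
    (TensorProduct.comm k (A ⊗[k] A) A).toLinearMap

namespace DoubleBracket

variable {k} {e : I → A} (D : DoubleBracket k e)

/-- The triple bracket `⦃a, b, c⦄` of a double bracket; `τ₍₁₃₂₎` is the square of `τ₍₁₂₃₎`. -/
def triple (a b c : A) : (A ⊗[k] A) ⊗[k] A :=
  D.extL a (D.toFun b c) + tau123 k A (D.extL b (D.toFun c a))
    + tau123 k A (tau123 k A (D.extL c (D.toFun a b)))

end DoubleBracket

/-- The triple bracket `(1/12) ∑ₛ ⦃-, -, -⦄_{Eₛ³}` attached to the gauge elements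
`Eₛ : a ↦ a eₛ ⊗ eₛ - eₛ ⊗ eₛ a`. -/
def tripleQP [Fintype I] (e : I → A) (a b c : A) : (A ⊗[k] A) ⊗[k] A :=
  (1 / 4 : k) • ∑ s,
    (((c * e s * a) ⊗ₜ[k] (e s * b)) ⊗ₜ[k] e s
      - ((c * e s * a) ⊗ₜ[k] e s) ⊗ₜ[k] (b * e s)
      - ((c * e s) ⊗ₜ[k] (a * e s * b)) ⊗ₜ[k] e s
      + ((c * e s) ⊗ₜ[k] (a * e s)) ⊗ₜ[k] (b * e s)
      - ((e s * a) ⊗ₜ[k] (e s * b)) ⊗ₜ[k] (e s * c)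
      + ((e s * a) ⊗ₜ[k] e s) ⊗ₜ[k] (b * e s * c)
      + (e s ⊗ₜ[k] (a * e s * b)) ⊗ₜ[k] (e s * c)
      - (e s ⊗ₜ[k] (a * e s)) ⊗ₜ[k] (b * e s * c))

/-- A double bracket is quasi-Poisson if its triple bracket is the one of `tripleQP`. -/
def DoubleBracket.IsQuasiPoisson {k : Type*} [Field k] {A : Type*} [Ring A] [Algebra k A]
    {I : Type*} [Fintype I] {e : I → A} (D : DoubleBracket k e) : Prop :=
  ∀ a b c, D.triple a b c = tripleQP k e a b c

end General

/-! Euler continuants. -/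

/-- The Euler continuant of a word read from right to left:
`eulerRev e [y_k, …, y_1] = (y_1, …, y_k)`, with `(y_1) = y_1`, `(y_1, y_2) = e + y_1 y_2` and
`(y_1, …, y_k) = (y_1, …, y_{k-1}) y_k + (y_1, …, y_{k-2})`. -/
def eulerRev {R : Type*} [Semiring R] (e : R) : List R → R
  | [] => e
  | [y] => y
  | y :: z :: l => eulerRev e (z :: l) * y + eulerRev e l

/-- The Euler continuant `(y_1, …, y_k)` of the list `[y_1, …, y_k]`; here `e` is the idempotent
at the head of `y_1`. -/
def eulerContinuant {R : Type*} [Semiring R] (e : R) (l : List R) : R :=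
  eulerRev e l.reverse

/-- The alternating word `[a_1, b_1, a_2, b_2, …, a_n, b_n]`. -/
def alternatingWord {R : Type*} {n : ℕ} (a b : Fin n → R) : List R :=
  (List.finRange n).flatMap fun i => [a i, b i]

/-! The Boalch algebra and the fission algebra. -/

/-- Generators of the Boalch algebra: the idempotents at the two vertices, the arrows
`a_i : 1 → 2` and `b_i : 2 → 1`, and the two inverses that are adjoined to the path algebra:
`invA` for `(a_1, …, b_n)⁻¹` and `invB` for `(b_n, …, a_1)⁻¹`. -/
inductive BoalchGen (n : ℕ) : Type
  | e₁ : BoalchGen n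
  | e₂ : BoalchGen n
  | a (i : Fin n) : BoalchGen n
  | b (i : Fin n) : BoalchGen n
  | invA : BoalchGen n
  | invB : BoalchGen n

section Boalch

variable (k : Type*) [Field k] (n : ℕ)

/-- A generator, as an element of the free algebra. -/
abbrev gen (x : BoalchGen n) : FreeAlgebra k (BoalchGen n) := FreeAlgebra.ι k x

/-- The continuant `(a_1, b_1, …, a_n, b_n)`, as an element of the free algebra. -/
def freeContA : FreeAlgebra k (BoalchGen n) :=
  eulerContinuant (gen k n .e₂)
    (alternatingWord (fun i => gen k n (.a i)) (fun i => gen k n (.b i)))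

/-- The continuant `(b_n, a_n, …, b_1, a_1)`, as an element of the free algebra. -/
def freeContB : FreeAlgebra k (BoalchGen n) :=
  eulerContinuant (gen k n .e₁)
    (alternatingWord (fun i => gen k n (.a i)) (fun i => gen k n (.b i))).reverse

/-- Defining relations of the Boalch algebra. The first group presents the path algebra of the
quiver with arrows `a_i : 1 → 2` and `b_i : 2 → 1` (paths are read from right to left), the other
two invert the continuants in `e₂ A e₂` and in `e₁ A e₁`. -/
inductive BoalchRel : FreeAlgebra k (BoalchGen n) → FreeAlgebra k (BoalchGen n) → Prop
  | one : BoalchRel (gen k n .e₁ + gen k n .e₂) 1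
  | e₁_e₁ : BoalchRel (gen k n .e₁ * gen k n .e₁) (gen k n .e₁)
  | e₂_e₂ : BoalchRel (gen k n .e₂ * gen k n .e₂) (gen k n .e₂)
  | e₁_e₂ : BoalchRel (gen k n .e₁ * gen k n .e₂) 0
  | e₂_e₁ : BoalchRel (gen k n .e₂ * gen k n .e₁) 0
  | a (i : Fin n) : BoalchRel (gen k n .e₂ * gen k n (.a i) * gen k n .e₁) (gen k n (.a i))
  | b (i : Fin n) : BoalchRel (gen k n .e₁ * gen k n (.b i) * gen k n .e₂) (gen k n (.b i))
  | e₂_invA : BoalchRel (gen k n .e₂ * gen k n .invA) (gen k n .invA)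
  | invA_e₂ : BoalchRel (gen k n .invA * gen k n .e₂) (gen k n .invA)
  | invA_mul : BoalchRel (gen k n .invA * freeContA k n) (gen k n .e₂)
  | mul_invA : BoalchRel (freeContA k n * gen k n .invA) (gen k n .e₂)
  | e₁_invB : BoalchRel (gen k n .e₁ * gen k n .invB) (gen k n .invB)
  | invB_e₁ : BoalchRel (gen k n .invB * gen k n .e₁) (gen k n .invB)
  | invB_mul : BoalchRel (gen k n .invB * freeContB k n) (gen k n .e₁)
  | mul_invB : BoalchRel (freeContB k n * gen k n .invB) (gen k n .e₁)

/-- The Boalch algebra `B(Γ_n)`. -/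
def BoalchAlgebra : Type _ := RingQuot (BoalchRel k n)

instance : Ring (BoalchAlgebra k n) := inferInstanceAs (Ring (RingQuot (BoalchRel k n)))

instance : Algebra k (BoalchAlgebra k n) :=
  inferInstanceAs (Algebra k (RingQuot (BoalchRel k n)))

namespace BoalchAlgebra

/-- The projection from the free algebra. -/
def mk : FreeAlgebra k (BoalchGen n) →ₐ[k] BoalchAlgebra k n :=
  RingQuot.mkAlgHom k (BoalchRel k n)

/-- The idempotent at vertex `1`. -/
def e₁ : BoalchAlgebra k n := mk k n (gen k n .e₁)

/-- The idempotent at vertex `2`. -/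
def e₂ : BoalchAlgebra k n := mk k n (gen k n .e₂)

/-- The two idempotents; they span `B = k e₁ ⊕ k e₂`. -/
def idem : Fin 2 → BoalchAlgebra k n := ![e₁ k n, e₂ k n]

variable {n} in
/-- The arrow `a_i : 1 → 2`. -/
def a (i : Fin n) : BoalchAlgebra k n := mk k n (gen k n (.a i))

variable {n} in
/-- The arrow `b_i : 2 → 1`. -/
def b (i : Fin n) : BoalchAlgebra k n := mk k n (gen k n (.b i))

/-- The continuant `(a_1, b_1, …, a_n, b_n)`. -/
def contA : BoalchAlgebra k n :=
  eulerContinuant (e₂ k n) (alternatingWord (a k) (b k))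

/-- The inverse `(b_n, a_n, …, b_1, a_1)⁻¹` in `e₁ B(Γ_n) e₁`. -/
def contBInv : BoalchAlgebra k n := mk k n (gen k n .invB)

end BoalchAlgebra

open BoalchAlgebra

/-- The relations `(b_n, …, a_1)⁻¹ = q₁ e₁` and `(a_1, …, b_n) = q₂ e₂`. -/
inductive FissionRel (q₁ q₂ : k) : BoalchAlgebra k n → BoalchAlgebra k n → Prop
  | vertex₁ : FissionRel q₁ q₂ (contBInv k n) (q₁ • e₁ k n)
  | vertex₂ : FissionRel q₁ q₂ (contA k n) (q₂ • e₂ k n)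

/-- The fission algebra `F^q(Γ_n)`, the quotient of `B(Γ_n)` by the two-sided ideal generated by
`(b_n, …, a_1)⁻¹ - q₁ e₁` and `(a_1, …, b_n) - q₂ e₂`. -/
def FissionAlgebra (q₁ q₂ : k) : Type _ := RingQuot (FissionRel k n q₁ q₂)

instance (q₁ q₂ : k) : Ring (FissionAlgebra k n q₁ q₂) :=
  inferInstanceAs (Ring (RingQuot (FissionRel k n q₁ q₂)))

instance (q₁ q₂ : k) : Algebra k (FissionAlgebra k n q₁ q₂) :=
  inferInstanceAs (Algebra k (RingQuot (FissionRel k n q₁ q₂)))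

/-- The projection `B(Γ_n) → F^q(Γ_n)`. -/
def FissionAlgebra.proj (q₁ q₂ : k) : BoalchAlgebra k n →ₐ[k] FissionAlgebra k n q₁ q₂ :=
  RingQuot.mkAlgHom k (FissionRel k n q₁ q₂)

variable {k n}

/-- The double bracket takes the prescribed values on the arrows. -/
structure IsEulerBracket (D : DoubleBracket k (idem k n)) : Prop where
  aa_lt : ∀ i j, i < j →
    D.toFun (a k i) (a k j) = -(1 / 2 : k) • (a k i ⊗ₜ[k] a k j + a k j ⊗ₜ[k] a k i)
  aa_eq : ∀ i, D.toFun (a k i) (a k i) = 0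
  aa_gt : ∀ i j, j < i →
    D.toFun (a k i) (a k j) = (1 / 2 : k) • (a k i ⊗ₜ[k] a k j + a k j ⊗ₜ[k] a k i)
  bb_lt : ∀ i j, i < j →
    D.toFun (b k i) (b k j) = -(1 / 2 : k) • (b k i ⊗ₜ[k] b k j + b k j ⊗ₜ[k] b k i)
  bb_eq : ∀ i, D.toFun (b k i) (b k i) = 0
  bb_gt : ∀ i j, j < i →
    D.toFun (b k i) (b k j) = (1 / 2 : k) • (b k i ⊗ₜ[k] b k j + b k j ⊗ₜ[k] b k i)
  ab_lt : ∀ i j, i < j →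
    D.toFun (a k i) (b k j) =
      (1 / 2 : k) • (e₁ k n ⊗ₜ[k] (a k i * b k j) + (b k j * a k i) ⊗ₜ[k] e₂ k n)
  ab_eq : ∀ i,
    D.toFun (a k i) (b k i) =
      (1 / 2 : k) • ((b k i * a k i) ⊗ₜ[k] e₂ k n + e₁ k n ⊗ₜ[k] (a k i * b k i))
        + e₁ k n ⊗ₜ[k] e₂ k n
  ab_gt : ∀ i j, j < i →
    D.toFun (a k i) (b k j) =
      -(1 / 2 : k) • ((b k j * a k i) ⊗ₜ[k] e₂ k n + e₁ k n ⊗ₜ[k] (a k i * b k j))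
        - (if (i : ℕ) = j + 1 then e₁ k n ⊗ₜ[k] e₂ k n else 0)
  ba_lt : ∀ i j, i < j →
    D.toFun (b k i) (a k j) =
      (1 / 2 : k) • (e₂ k n ⊗ₜ[k] (b k i * a k j) + (a k j * b k i) ⊗ₜ[k] e₁ k n)
        + (if (j : ℕ) = i + 1 then e₂ k n ⊗ₜ[k] e₁ k n else 0)
  ba_eq : ∀ i,
    D.toFun (b k i) (a k i) =
      -(1 / 2 : k) • (e₂ k n ⊗ₜ[k] (b k i * a k i) + (a k i * b k i) ⊗ₜ[k] e₁ k n)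
        - e₂ k n ⊗ₜ[k] e₁ k n
  ba_gt : ∀ i j, j < i →
    D.toFun (b k i) (a k j) =
      -(1 / 2 : k) • ((a k j * b k i) ⊗ₜ[k] e₁ k n + e₂ k n ⊗ₜ[k] (b k i * a k j))

end Boalch

end NCPoisson

/-!
The double bracket is built on the free algebra on the generators of the Boalch algebra, as the
biderivation with prescribed values on pairs of generators, and then descended. A derivation is a
homomorphism to upper triangular `2 × 2` matrices, so a derivation of the free algebra is determined
by arbitrary values on the generators, and it descends to the quotient as soon as it respects the
relations (`IsTwistedDerivation.eq_zero_of_mkAlgHom`, `exists_doubleBracket`).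

The relations at stake are those that invert the continuants. Number the letters of the word
`a_1, b_1, …, a_n, b_n` by their positions; then all the brackets of arrows are instances of one
formula `letterBracket`, in which only the sign of the difference of the positions and the adjacency
of the positions occur. An induction over the initial segments of the word (`bracket_continuant`)
shows that the bracket of a letter `x` with the continuant `Φ` of the whole word is
`½ (f x ⊗ Φ - f ⊗ x Φ + Φ x ⊗ f - Φ ⊗ x f)`, where `f` is the idempotent of the vertex of `Φ`: this
is the multiplicative moment map condition. Reversing the word changes the sign of every bracket of
letters, so the other continuant satisfies it up to sign. Since the condition passes to inverses,
the prescribed values on the adjoined inverses are consistent, which gives existence. A derivation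
of the Boalch algebra that kills the idempotents and the arrows kills the continuants, hence their
inverses (`BoalchAlgebra.derivation_eq_zero`), which gives uniqueness.

For the quasi-Poisson property, the triple bracket and `tripleQP` are both derivations in the last
argument and invariant under cyclic permutations, so it is enough to compare them on triples of
arrows. Up to rotation there are two cases, three parallel arrows and two parallel arrows with an
opposite one (`triple_parallel`, `triple_opposite`); in both the difference vanishes because of an
identity between the signs of the differences of three positions.

The moment map condition implies that `{x, -}` kills both continuants and their inverses, since the
product of `A` sends `f x ⊗ Φ - f ⊗ x Φ` and `Φ x ⊗ f - Φ ⊗ x f` to `0`. Hence the derivations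
`{x, -}` descend to the fission algebra. The bracket on `H₀` is antisymmetric because the product of
`A` is commutative modulo commutators, and it satisfies the Jacobi identity because its Jacobiator
is `m ⦃a, b, c⦄ - m ⦃a, c, b⦄` modulo commutators, while `m` kills `tripleQP`
(`DoubleBracket.IsQuasiPoisson.jacobi`).
-/

namespace NCPoisson

/-! ### Derivations of free algebras and biderivations -/

section Derivations

variable {k : Type*} [Field k] {A S X : Type*} [Ring A] [Algebra k A] [Ring S] [Algebra k S]

/-- A derivation `d : A → S`, where the ring `S` is an `A`-bimodule through two algebra
homomorphisms `L` (acting on the left) and `R` (acting on the right). -/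
def IsTwistedDerivation (L R : A →ₐ[k] S) (d : A →ₗ[k] S) : Prop :=
  ∀ a b, d (a * b) = d a * R b + L a * d b

namespace IsTwistedDerivation

variable {L R : A →ₐ[k] S} {d : A →ₗ[k] S}

theorem map_one (h : IsTwistedDerivation L R d) : d 1 = 0 := by
  simpa using h 1 1

/-- A twisted derivation is the same as a homomorphism to upper triangular matrices. -/
def toMatrix (h : IsTwistedDerivation L R d) : A →ₐ[k] Matrix (Fin 2) (Fin 2) S :=
  AlgHom.ofLinearMap
    { toFun := fun a => !![L a, d a; 0, R a]
      map_add' := fun a b => by ext i j; fin_cases i <;> fin_cases j <;> simp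
      map_smul' := fun c a => by ext i j; fin_cases i <;> fin_cases j <;> simp }
    (by ext i j; fin_cases i <;> fin_cases j <;> simp [h.map_one])
    (fun a b => by
      ext i j
      fin_cases i <;> fin_cases j <;> simp [Matrix.mul_apply, Fin.sum_univ_two, h a b, add_comm])

theorem toMatrix_apply (h : IsTwistedDerivation L R d) (a : A) :
    h.toMatrix a = !![L a, d a; 0, R a] := rfl

/-- A twisted derivation that identifies related elements kills the kernel of the projection to
the quotient by the relations. -/
theorem eq_zero_of_mkAlgHom {r : A → A → Prop} (h : IsTwistedDerivation L R d)
    (hL : ∀ u v, r u v → L u = L v) (hR : ∀ u v, r u v → R u = R v)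
    (hd : ∀ u v, r u v → d u = d v) {z : A} (hz : RingQuot.mkAlgHom k r z = 0) : d z = 0 := by
  let Θ := RingQuot.liftAlgHom k (s := r) ⟨h.toMatrix, fun u v huv => by
    rw [toMatrix_apply, toMatrix_apply, hL u v huv, hR u v huv, hd u v huv]⟩
  have h1 : Θ (RingQuot.mkAlgHom k r z) = h.toMatrix z := RingQuot.liftAlgHom_mkAlgHom_apply ..
  rw [hz, _root_.map_zero, toMatrix_apply] at h1
  simpa using (congrFun (congrFun h1 0) 1).symm

theorem sub {d' : A →ₗ[k] S} (h : IsTwistedDerivation L R d) (h' : IsTwistedDerivation L R d') :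
    IsTwistedDerivation L R (d - d') := by
  intro a b
  simp only [LinearMap.sub_apply, h a b, h' a b, sub_mul, mul_sub]
  abel

end IsTwistedDerivation

/-- The twisted derivation of the free algebra with prescribed values on the generators. -/
def freeDerivation (L R : FreeAlgebra k X →ₐ[k] S) (f : X → S) : FreeAlgebra k X →ₗ[k] S :=
  Matrix.entryLinearMap k S (0 : Fin 2) (1 : Fin 2) ∘ₗ
    (FreeAlgebra.lift k fun x =>
      !![L (FreeAlgebra.ι k x), f x; 0, R (FreeAlgebra.ι k x)]).toLinearMap

theorem freeDerivation_ι (L R : FreeAlgebra k X →ₐ[k] S) (f : X → S) (x : X) :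
    freeDerivation L R f (FreeAlgebra.ι k x) = f x := by
  simp [freeDerivation]

theorem isTwistedDerivation_freeDerivation (L R : FreeAlgebra k X →ₐ[k] S) (f : X → S) :
    IsTwistedDerivation L R (freeDerivation L R f) := by
  set Θ := FreeAlgebra.lift k fun x => !![L (FreeAlgebra.ι k x), f x; 0, R (FreeAlgebra.ι k x)]
    with hΘ
  have key : ∀ z, Θ z 0 0 = L z ∧ Θ z 1 0 = 0 ∧ Θ z 1 1 = R z := by
    intro z
    induction z using FreeAlgebra.induction with
    | grade0 c => simp [Matrix.algebraMap_matrix_apply]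
    | grade1 x => simp [hΘ]
    | mul a b ha hb =>
      simp [Matrix.mul_apply, Fin.sum_univ_two, ha.1, ha.2.1, ha.2.2, hb.1, hb.2.1, hb.2.2]
    | add a b ha hb => simp [ha.1, ha.2.1, ha.2.2, hb.1, hb.2.1, hb.2.2]
  intro a b
  change Θ (a * b) 0 1 = Θ a 0 1 * R b + L a * Θ b 0 1
  rw [map_mul, Matrix.mul_apply, Fin.sum_univ_two, (key a).1, (key b).2.2, add_comm]

end Derivations

section Biderivations

variable {k : Type*} [Field k] {A X : Type*} [Ring A] [Algebra k A]

/-- The left outer action of `A` on `A ⊗ A`. -/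
abbrev outerLeft (k A : Type*) [Field k] [Ring A] [Algebra k A] : A →ₐ[k] A ⊗[k] A :=
  Algebra.TensorProduct.includeLeft

/-- The right outer action of `A` on `A ⊗ A`. -/
abbrev outerRight (k A : Type*) [Field k] [Ring A] [Algebra k A] : A →ₐ[k] A ⊗[k] A :=
  Algebra.TensorProduct.includeRight

/-- The derivation of the free algebra, for the outer bimodule structure of `A ⊗ A` along `π`,
with prescribed values on the generators. -/
def outerDerivation (π : FreeAlgebra k X →ₐ[k] A) (f : X → A ⊗[k] A) :
    FreeAlgebra k X →ₗ[k] A ⊗[k] A :=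
  freeDerivation ((outerLeft k A).comp π) ((outerRight k A).comp π) f

variable (π : FreeAlgebra k X →ₐ[k] A) (β : X → X → A ⊗[k] A)

theorem outerDerivation_ι (f : X → A ⊗[k] A) (x : X) :
    outerDerivation π f (FreeAlgebra.ι k x) = f x := freeDerivation_ι ..

theorem outerDerivation_mul (f : X → A ⊗[k] A) (a b : FreeAlgebra k X) :
    outerDerivation π f (a * b)
      = outerDerivation π f a * (1 ⊗ₜ[k] π b) + (π a ⊗ₜ[k] 1) * outerDerivation π f b :=
  isTwistedDerivation_freeDerivation _ _ _ a b

theorem outerDerivation_one (f : X → A ⊗[k] A) : outerDerivation π f 1 = 0 :=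
  (isTwistedDerivation_freeDerivation _ _ _).map_one

/-- The extension of `outerDerivation` from generators to arbitrary first arguments. It takes
values in functions, which form a bimodule through the inner bimodule structure of `A ⊗ A`. -/
def freeBracketFun : FreeAlgebra k X →ₗ[k] FreeAlgebra k X → A ⊗[k] A :=
  freeDerivation
    ((Pi.constAlgHom k (FreeAlgebra k X) (A ⊗[k] A)).comp ((outerRight k A).comp π))
    ((Pi.constAlgHom k (FreeAlgebra k X) (A ⊗[k] A)).comp ((outerLeft k A).comp π))
    fun x => ⇑(outerDerivation π (β x))

theorem freeBracketFun_ι (x : X) (z : FreeAlgebra k X) :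
    freeBracketFun π β (FreeAlgebra.ι k x) z = outerDerivation π (β x) z := by
  rw [freeBracketFun, freeDerivation_ι]

theorem freeBracketFun_mul_left (a b z : FreeAlgebra k X) :
    freeBracketFun π β (a * b) z =
      freeBracketFun π β a z * (π b ⊗ₜ[k] 1) + (1 ⊗ₜ[k] π a) * freeBracketFun π β b z :=
  congrFun (isTwistedDerivation_freeDerivation _ _ _ a b) z

theorem freeBracketFun_one (z : FreeAlgebra k X) : freeBracketFun π β 1 z = 0 :=
  congrFun (isTwistedDerivation_freeDerivation (k := k) (X := X)
    ((Pi.constAlgHom k (FreeAlgebra k X) (A ⊗[k] A)).comp ((outerRight k A).comp π))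
    ((Pi.constAlgHom k (FreeAlgebra k X) (A ⊗[k] A)).comp ((outerLeft k A).comp π)) _).map_one z

/-- The biderivation of the free algebra, with values in `A ⊗ A`, with prescribed values on pairs
of generators. -/
def freeBracket : FreeAlgebra k X →ₗ[k] FreeAlgebra k X →ₗ[k] A ⊗[k] A :=
  LinearMap.mk₂ k (fun a z => freeBracketFun π β a z)
    (fun a b z => by simp) (fun c a z => by simp)
    (fun a z w => by
      induction a using FreeAlgebra.induction with
      | grade0 c =>
        simp [Algebra.algebraMap_eq_smul_one, freeBracketFun_one]
      | grade1 x => simp [freeBracketFun_ι]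
      | mul a b ha hb => rw [freeBracketFun_mul_left, ha, hb, freeBracketFun_mul_left,
          freeBracketFun_mul_left, add_mul, mul_add]; abel
      | add a b ha hb => simp only [map_add, Pi.add_apply, ha, hb]; abel)
    (fun c a z => by
      induction a using FreeAlgebra.induction with
      | grade0 c =>
        simp [Algebra.algebraMap_eq_smul_one, freeBracketFun_one]
      | grade1 x => simp [freeBracketFun_ι]
      | mul a b ha hb => rw [freeBracketFun_mul_left, ha, hb, freeBracketFun_mul_left,
          smul_add, smul_mul_assoc, mul_smul_comm]
      | add a b ha hb => simp only [map_add, Pi.add_apply, ha, hb, smul_add])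

theorem freeBracket_ι (x : X) (z : FreeAlgebra k X) :
    freeBracket π β (FreeAlgebra.ι k x) z = outerDerivation π (β x) z :=
  freeBracketFun_ι π β x z

theorem freeBracket_mul_left (a b z : FreeAlgebra k X) :
    freeBracket π β (a * b) z =
      freeBracket π β a z * (π b ⊗ₜ[k] 1) + (1 ⊗ₜ[k] π a) * freeBracket π β b z :=
  freeBracketFun_mul_left π β a b z

theorem freeBracket_one_left (z : FreeAlgebra k X) : freeBracket π β 1 z = 0 :=
  freeBracketFun_one π β z

theorem freeBracket_mul_right (a z w : FreeAlgebra k X) :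
    freeBracket π β a (z * w) =
      freeBracket π β a z * (1 ⊗ₜ[k] π w) + (π z ⊗ₜ[k] 1) * freeBracket π β a w := by
  induction a using FreeAlgebra.induction with
  | grade0 c => simp [Algebra.algebraMap_eq_smul_one, freeBracket_one_left]
  | grade1 x => simp only [freeBracket_ι, outerDerivation_mul]
  | mul a b ha hb =>
    have h1 : (1 ⊗ₜ[k] π w) * (π b ⊗ₜ[k] (1 : A)) = (π b ⊗ₜ[k] 1) * ((1 : A) ⊗ₜ[k] π w) := by simp
    have h2 : ((1 : A) ⊗ₜ[k] π a) * (π z ⊗ₜ[k] 1) = (π z ⊗ₜ[k] (1 : A)) * (1 ⊗ₜ[k] π a) := by simp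
    simp only [freeBracket_mul_left, ha, hb, add_mul, mul_add, mul_assoc, h1]
    simp only [← mul_assoc, h2]
    abel
  | add a b ha hb => simp only [map_add, LinearMap.add_apply, ha, hb, add_mul, mul_add]; abel

theorem freeBracket_one_right (a : FreeAlgebra k X) : freeBracket π β a 1 = 0 := by
  simpa [← Algebra.TensorProduct.one_def] using freeBracket_mul_right π β a 1 1

theorem freeBracket_antisymm (hβ : ∀ x y, β x y = -TensorProduct.comm k A A (β y x))
    (a z : FreeAlgebra k X) :
    freeBracket π β a z = -TensorProduct.comm k A A (freeBracket π β z a) := by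
  have hmul : ∀ s t : A ⊗[k] A, TensorProduct.comm k A A (s * t)
      = TensorProduct.comm k A A s * TensorProduct.comm k A A t :=
    fun s t => map_mul (Algebra.TensorProduct.comm k A A) s t
  induction a using FreeAlgebra.induction with
  | grade0 c =>
    simp [Algebra.algebraMap_eq_smul_one, freeBracket_one_left, freeBracket_one_right]
  | grade1 x =>
    induction z using FreeAlgebra.induction with
    | grade0 c => simp [Algebra.algebraMap_eq_smul_one, freeBracket_one_left, freeBracket_one_right]
    | grade1 y => rw [freeBracket_ι, freeBracket_ι, outerDerivation_ι, outerDerivation_ι, hβ]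
    | mul z w hz hw =>
      rw [freeBracket_mul_right, freeBracket_mul_left, hz, hw]
      simp only [map_add, hmul, TensorProduct.comm_tmul, neg_mul, mul_neg]
      abel
    | add z w hz hw => rw [map_add, hz, hw, map_add, LinearMap.add_apply, map_add]; abel
  | mul a b ha hb =>
    rw [freeBracket_mul_right, freeBracket_mul_left, ha, hb]
    simp only [map_add, hmul, TensorProduct.comm_tmul, neg_mul, mul_neg]
    abel
  | add a b ha hb =>
    rw [map_add, LinearMap.add_apply, ha, hb, map_add, map_add]
    abel

/-- An antisymmetric family of values on pairs of generators extends to a double bracket on a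
quotient `A` of the free algebra, as soon as the derivations `⦃x, -⦄` attached to the generators
kill the kernel of the projection. -/
theorem exists_doubleBracket (hπ : Function.Surjective π)
    (hβ : ∀ x y, β x y = -TensorProduct.comm k A A (β y x))
    (hker : ∀ x z, π z = 0 → outerDerivation π (β x) z = 0)
    {I : Type*} (e : I → X) (he : ∀ s y, β (e s) y = 0) :
    ∃ D : DoubleBracket k (fun s => π (FreeAlgebra.ι k (e s))),
      ∀ a z, D.toFun (π a) (π z) = freeBracket π β a z := by
  have hker' : ∀ a z, π z = 0 → freeBracket π β a z = 0 := by
    intro a z hz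
    induction a using FreeAlgebra.induction with
    | grade0 c => simp [Algebra.algebraMap_eq_smul_one, freeBracket_one_left]
    | grade1 x => rw [freeBracket_ι, hker x z hz]
    | mul a b ha hb => rw [freeBracket_mul_left, ha, hb, zero_mul, mul_zero, add_zero]
    | add a b ha hb => rw [map_add, LinearMap.add_apply, ha, hb, add_zero]
  have hanti := freeBracket_antisymm π β hβ
  obtain ⟨s, hs⟩ := LinearMap.exists_rightInverse_of_surjective π.toLinearMap
    (LinearMap.range_eq_top.2 hπ)
  have hs' : ∀ a, π (s a) = a := fun a => LinearMap.congr_fun hs a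
  have hr : ∀ a z w, π z = π w → freeBracket π β a z = freeBracket π β a w := fun a z w h => by
    rw [← sub_eq_zero, ← map_sub]
    exact hker' a _ (by rw [map_sub, h, sub_self])
  have hl : ∀ a z w, π z = π w → freeBracket π β z a = freeBracket π β w a := fun a z w h => by
    rw [hanti z, hanti w, hr a z w h]
  have hD : ∀ a z, (freeBracket π β).compl₁₂ s s (π a) (π z) = freeBracket π β a z := fun a z => by
    rw [LinearMap.compl₁₂_apply, hr _ _ z (hs' _), hl _ _ a (hs' _)]
  refine ⟨⟨(freeBracket π β).compl₁₂ s s, fun a b => ?_, fun a b c => ?_, fun a i => ?_⟩, hD⟩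
  · exact hanti _ _
  · rw [← hs' a, ← hs' b, ← hs' c, ← map_mul, hD, hD, hD, freeBracket_mul_right]
  · have h0 : ∀ z, outerDerivation π (β (e i)) z = 0 := by
      intro z
      induction z using FreeAlgebra.induction with
      | grade0 c => simp [Algebra.algebraMap_eq_smul_one, outerDerivation_one]
      | grade1 x => rw [outerDerivation_ι, he]
      | mul a b ha hb => rw [outerDerivation_mul, ha, hb, zero_mul, mul_zero, add_zero]
      | add a b ha hb => rw [map_add, ha, hb, add_zero]
    rw [← hs' a, hD, hanti, freeBracket_ι, h0, map_zero, neg_zero]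

end Biderivations

/-! ### The bracket of a letter with a continuant -/

section ContinuantBracket

variable {k : Type*} [Field k] {A : Type*} [Ring A] [Algebra k A]

/-- The sign of `p - q`. -/
def posSign (k : Type*) [Field k] (p q : ℕ) : k := if p < q then -1 else if p = q then 0 else 1

/-- The sign of `q - p` if `p` and `q` are adjacent, and `0` otherwise. -/
def adjSign (k : Type*) [Field k] (p q : ℕ) : k :=
  if q = p + 1 then 1 else if p = q + 1 then -1 else 0

theorem posSign_swap (p q : ℕ) : posSign k q p = -posSign k p q := by
  unfold posSign
  split_ifs <;> first | omega | simp

theorem adjSign_swap (p q : ℕ) : adjSign k q p = -adjSign k p q := by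
  unfold adjSign
  split_ifs <;> first | omega | simp

/-- The bracket `⦃x, y⦄` of two letters at positions `p` and `q`, where `y = u y v`. If `x` and
`y` are parallel then only the first two terms of the first summand survive; if they are opposite
then only the last two do. -/
def letterBracket (p q : ℕ) (u v x y : A) : A ⊗[k] A :=
  (posSign k p q / 2) • ((u * x) ⊗ₜ[k] y + y ⊗ₜ[k] (x * v) - u ⊗ₜ[k] (x * y) - (y * x) ⊗ₜ[k] v)
    + adjSign k p q • u ⊗ₜ[k] v

/-- The bracket `D q` of the `p`-th letter `y p` with the continuant `c q` of the first `q - 1`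
letters; here `h q` is the idempotent at the head of the `q`-th letter, and `c 0 = 0` makes the
recursion start at `c 2 = y 0`. Passing the position `p` flips the sign of the terms in which
`c q` stands in the left tensor factor, and the adjacency term contributes only to the continuant
of the letters before `y p`. -/
theorem bracket_continuant [CharZero k] {h y c : ℕ → A} {D : ℕ → A ⊗[k] A} {p m : ℕ}
    (hh : ∀ q, h (q + 2) = h q) (hidem : ∀ q, h q * h q = h q) (horth : ∀ q, h q * h (q + 1) = 0)
    (hy : ∀ q, h q * y q = y q) (yh : ∀ q, y q * h (q + 1) = y q)
    (c0 : c 0 = 0) (c1 : c 1 = h 0) (c2 : ∀ q, c (q + 2) = c (q + 1) * y q + c q)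
    (D0 : D 0 = 0) (D1 : D 1 = 0)
    (D2 : ∀ q, q < m → D (q + 2) = D (q + 1) * (1 ⊗ₜ[k] y q)
      + (c (q + 1) ⊗ₜ[k] 1) * letterBracket p q (h q) (h (q + 1)) (y p) (y q) + D q)
    (q : ℕ) (hq : q ≤ m + 1) :
    D q = (1 / 2 : k) • ((h 0 * y p) ⊗ₜ[k] c q - h 0 ⊗ₜ[k] (y p * c q)
        + (if q < p + 2 then (-1 : k) else 1) • ((c q * y p) ⊗ₜ[k] h (q + 1)
          - c q ⊗ₜ[k] (y p * h (q + 1))))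
      - if q = p + 1 then c p ⊗ₜ[k] h p else 0 := by
  have horth' : ∀ q, h (q + 1) * h q = 0 := fun q => by rw [← hh q]; exact horth (q + 1)
  have ch : ∀ q, c (q + 1) * h q = c (q + 1) := by
    intro q
    induction q using Nat.twoStepInduction with
    | zero => rw [c1, hidem]
    | one => rw [c2, c0, c1, add_zero, mul_assoc, yh]
    | more q h1 h2 => rw [c2, add_mul, mul_assoc, yh, hh, h1]
  induction q using Nat.twoStepInduction with
  | zero => simp [D0, c0]
  | one =>
    have h2 := hh 0
    by_cases hp : p = 0
    · simp [D1, c1, h2, hp, c0]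
    · simp [D1, c1, h2, hp]
  | more q h1 h2 =>
    rw [D2 q (by omega), h1 (by omega), h2 (by omega)]
    have hpx : y p * y p = 0 := by
      rw [← yh, ← hy p, mul_assoc, mul_assoc, mul_assoc (h p), ← mul_assoc (h (p + 1)), horth',
        zero_mul, mul_zero, mul_zero]
    have hcp : c p * h (p + 1) = c p := by
      rcases p with _ | p
      · rw [c0, zero_mul]
      · rw [hh p, ch]
    have hc0 : c p * y p = 0 := by
      rw [← hcp, ← hy p, mul_assoc, ← mul_assoc (h (p + 1)), horth', zero_mul, mul_zero]
    have hxp : y p * h p = 0 := by rw [← yh, mul_assoc, horth', mul_zero]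
    have e1 : h (q + 2 + 1) = h (q + 1) := hh (q + 1)
    have e2 : h (q + 1 + 1) = h q := hh q
    have e3 := ch q
    have e4 := hy q
    have e6 := yh q
    have e7 : c (q + 2) = _ := c2 q
    have e8 : c (p + 1 + 1) = _ := c2 p
    have e9 : h (p + 1 + 1) = h p := hh p
    have e10 := yh p
    simp only [letterBracket, posSign, adjSign]
    -- The five cases are the positions of the new letter relative to the letter `p`.
    have hl : q + 2 < p + 1 ∨ p = q + 1 ∨ q = p ∨ q = p + 1 ∨ p + 1 < q := by omega
    rcases hl with hl | rfl | rfl | rfl | hl <;>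
      simp (disch := omega) only [if_pos, if_neg, if_true] <;>
      simp only [e1, e2, e7, e8, e9, mul_add, add_mul, mul_sub, sub_mul, TensorProduct.tmul_add,
        TensorProduct.add_tmul, smul_mul_assoc, mul_smul_comm, ← mul_assoc, e3, hcp,
        Algebra.TensorProduct.tmul_mul_tmul, mul_one, one_mul, zero_mul] <;>
      simp only [mul_assoc, e4, hpx, hc0, hxp, e6, e10, zero_mul, mul_zero,
        TensorProduct.tmul_zero, TensorProduct.zero_tmul] <;>
      module

end ContinuantBracket

/-! ### The moment map condition -/

section MomentBracket

variable {k : Type*} [Field k] {A : Type*} [Ring A] [Algebra k A]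

/-- The value `⦃x, φ⦄` prescribed by the multiplicative moment map condition for an invertible
element `φ` of the corner `f A f`. -/
def momentBracket (f φ x : A) : A ⊗[k] A :=
  (1 / 2 : k) • ((f * x) ⊗ₜ[k] φ - f ⊗ₜ[k] (x * φ) + (φ * x) ⊗ₜ[k] f - φ ⊗ₜ[k] (x * f))

theorem comm_momentBracket (f φ x : A) :
    TensorProduct.comm k A A (momentBracket f φ x) =
      ((1 / 2 : k) • (φ ⊗ₜ[k] f + f ⊗ₜ[k] φ)) * (1 ⊗ₜ[k] x)
        - (x ⊗ₜ[k] 1) * ((1 / 2 : k) • (φ ⊗ₜ[k] f + f ⊗ₜ[k] φ)) := by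
  simp only [momentBracket, map_smul, map_sub, map_add, TensorProduct.comm_tmul, smul_mul_assoc,
    mul_smul_comm, add_mul, mul_add, Algebra.TensorProduct.tmul_mul_tmul, mul_one, one_mul]
  module

theorem momentBracket_mul_right {f φ ψ : A} (hf : f * ψ = ψ) (h : φ * ψ = f) (x : A) :
    momentBracket f φ x * (1 ⊗ₜ[k] ψ) = (1 / 2 : k) •
      ((f * x) ⊗ₜ[k] f - f ⊗ₜ[k] (x * f) + (φ * x) ⊗ₜ[k] ψ - φ ⊗ₜ[k] (x * ψ)) := by
  simp only [momentBracket, smul_mul_assoc, add_mul, sub_mul, Algebra.TensorProduct.tmul_mul_tmul,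
    mul_one, mul_assoc, hf, h]

theorem mul_momentBracket {f φ ψ : A} (hf : φ * f = φ) (h : φ * ψ = f) (x : A) :
    (φ ⊗ₜ[k] 1) * momentBracket f ψ x = (1 / 2 : k) •
      ((f * x) ⊗ₜ[k] f - f ⊗ₜ[k] (x * f) + (φ * x) ⊗ₜ[k] ψ - φ ⊗ₜ[k] (x * ψ)) := by
  simp only [momentBracket, mul_smul_comm, mul_add, mul_sub, Algebra.TensorProduct.tmul_mul_tmul,
    one_mul, ← mul_assoc, hf, h]
  module

end MomentBracket

section Words

/-- The continuant of the first `q` letters of a word. -/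
def prefixContinuant {R : Type*} [Semiring R] (e : R) (w : ℕ → R) (q : ℕ) : R :=
  eulerContinuant e ((List.range q).map w)

theorem prefixContinuant_succ_succ {R : Type*} [Semiring R] (e : R) (w : ℕ → R) (q : ℕ) :
    prefixContinuant e w (q + 2)
      = prefixContinuant e w (q + 1) * w (q + 1) + prefixContinuant e w q := by
  simp [prefixContinuant, eulerContinuant, List.range_succ, eulerRev]

theorem alternatingWord_eq_map_range {R : Type*} {n : ℕ} {a b : Fin n → R} {w : ℕ → R}
    (ha : ∀ i : Fin n, w (2 * i) = a i) (hb : ∀ i : Fin n, w (2 * i + 1) = b i) :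
    alternatingWord a b = (List.range (2 * n)).map w := by
  have h1 : alternatingWord a b =
      ((List.finRange n).map Fin.val).flatMap fun i => [w (2 * i), w (2 * i + 1)] := by
    rw [List.flatMap_map]
    simp [alternatingWord, ha, hb]
  rw [h1, List.map_coe_finRange_eq_range]
  clear h1 ha hb a b
  induction n with
  | zero => rfl
  | succ n ih =>
    rw [List.range_succ, List.flatMap_append, ih, show 2 * (n + 1) = 2 * n + 1 + 1 by ring,
      List.range_succ, List.range_succ]
    simp

variable {k : Type*} [Field k] {F A : Type*} [Ring F] [Algebra k F] [Ring A]
  [Algebra k A]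

theorem head_mul_prefixContinuant {π : F →ₐ[k] A} {h : ℕ → A} {w : ℕ → F} {e : F}
    (hidem : ∀ q, h q * h q = h q) (hw : ∀ q, h q * π (w q) = π (w q)) (he : π e = h 0) (q : ℕ) :
    h 0 * π (prefixContinuant e w q) = π (prefixContinuant e w q) := by
  induction q using Nat.twoStepInduction with
  | zero => simp [prefixContinuant, eulerContinuant, eulerRev, he, hidem]
  | one => simp [prefixContinuant, eulerContinuant, eulerRev, hw]
  | more q h1 h2 =>
    rw [prefixContinuant_succ_succ, map_add, map_mul, mul_add, ← mul_assoc, h1, h2]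

theorem prefixContinuant_mul_tail {π : F →ₐ[k] A} {h : ℕ → A} {w : ℕ → F} {e : F}
    (hh : ∀ q, h (q + 2) = h q) (hidem : ∀ q, h q * h q = h q)
    (wh : ∀ q, π (w q) * h (q + 1) = π (w q)) (he : π e = h 0) (q : ℕ) :
    π (prefixContinuant e w q) * h q = π (prefixContinuant e w q) := by
  induction q using Nat.twoStepInduction with
  | zero => simp [prefixContinuant, eulerContinuant, eulerRev, he, hidem]
  | one => simp [prefixContinuant, eulerContinuant, eulerRev, wh]
  | more q h1 h2 =>
    rw [prefixContinuant_succ_succ, map_add, map_mul, add_mul, mul_assoc, wh, hh, h1]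

/-- The bracket of a letter with the continuant of a whole word of even length is the one of the
moment map condition. -/
theorem derivation_prefixContinuant [CharZero k] {π : F →ₐ[k] A} {d : F →ₗ[k] A ⊗[k] A}
    (hd : ∀ a b, d (a * b) = d a * (1 ⊗ₜ[k] π b) + (π a ⊗ₜ[k] 1) * d b)
    {h : ℕ → A} {w : ℕ → F} {e : F} {p m : ℕ} (hp : p < m)
    (hh : ∀ q, h (q + 2) = h q) (hidem : ∀ q, h q * h q = h q) (horth : ∀ q, h q * h (q + 1) = 0)
    (hw : ∀ q, h q * π (w q) = π (w q)) (wh : ∀ q, π (w q) * h (q + 1) = π (w q))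
    (he : π e = h 0) (de : d e = 0) (hm : h m = h 0)
    (dw : ∀ q, q < m → d (w q) = letterBracket p q (h q) (h (q + 1)) (π (w p)) (π (w q))) :
    d (prefixContinuant e w m) = momentBracket (h 0) (π (prefixContinuant e w m)) (π (w p)) := by
  have key := bracket_continuant (k := k) (h := h) (y := fun q => π (w q))
    (c := fun q => match q with | 0 => 0 | q + 1 => π (prefixContinuant e w q))
    (D := fun q => match q with | 0 => 0 | q + 1 => d (prefixContinuant e w q)) (p := p) (m := m)
    hh hidem horth hw wh rfl (by simpa [prefixContinuant, eulerContinuant, eulerRev] using he) ?_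
    rfl (by simpa [prefixContinuant, eulerContinuant, eulerRev] using de) ?_ (m + 1) le_rfl
  · rw [if_neg (by omega), if_neg (by omega), hh, hm, sub_zero, one_smul] at key
    rw [momentBracket]
    exact key.trans (by congr 1)
  · intro q
    cases q with
    | zero =>
      have := hw 0
      simpa [prefixContinuant, eulerContinuant, eulerRev, he] using this.symm
    | succ q => simp [prefixContinuant_succ_succ]
  · intro q hq
    cases q with
    | zero =>
      have := hw 0
      simp [prefixContinuant, eulerContinuant, eulerRev, de, dw 0 hq, he, letterBracket, mul_add,
        mul_sub, ← mul_assoc, hidem, hw]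
    | succ q => simp [prefixContinuant_succ_succ, hd, dw _ hq]

end Words

/-! ### The Boalch algebra -/

namespace BoalchAlgebra

variable {k : Type*} [Field k] {n : ℕ}

theorem mk_surjective : Function.Surjective (mk k n) := RingQuot.mkAlgHom_surjective _ _

theorem mk_eq_mk {u v : FreeAlgebra k (BoalchGen n)} (h : BoalchRel k n u v) :
    mk k n u = mk k n v := RingQuot.mkAlgHom_rel k h

@[simp] theorem e₁_mul_e₁ : e₁ k n * e₁ k n = e₁ k n := by
  simpa [e₁] using mk_eq_mk (.e₁_e₁ (k := k) (n := n))

@[simp] theorem e₂_mul_e₂ : e₂ k n * e₂ k n = e₂ k n := by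
  simpa [e₂] using mk_eq_mk (.e₂_e₂ (k := k) (n := n))

@[simp] theorem e₁_mul_e₂ : e₁ k n * e₂ k n = 0 := by
  simpa [e₁, e₂] using mk_eq_mk (.e₁_e₂ (k := k) (n := n))

@[simp] theorem e₂_mul_e₁ : e₂ k n * e₁ k n = 0 := by
  simpa [e₁, e₂] using mk_eq_mk (.e₂_e₁ (k := k) (n := n))

theorem e₂_mul_a_mul_e₁ (i : Fin n) : e₂ k n * a k i * e₁ k n = a k i := by
  simpa [e₁, e₂, a] using mk_eq_mk (.a (k := k) i)

theorem e₁_mul_b_mul_e₂ (i : Fin n) : e₁ k n * b k i * e₂ k n = b k i := by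
  simpa [e₁, e₂, b] using mk_eq_mk (.b (k := k) i)

@[simp] theorem e₂_mul_a (i : Fin n) : e₂ k n * a k i = a k i := by
  rw [← e₂_mul_a_mul_e₁, ← mul_assoc, ← mul_assoc, e₂_mul_e₂]

@[simp] theorem a_mul_e₁ (i : Fin n) : a k i * e₁ k n = a k i := by
  rw [← e₂_mul_a_mul_e₁, mul_assoc, e₁_mul_e₁]

@[simp] theorem e₁_mul_a (i : Fin n) : e₁ k n * a k i = 0 := by
  rw [← e₂_mul_a, ← mul_assoc, e₁_mul_e₂, zero_mul]

@[simp] theorem a_mul_e₂ (i : Fin n) : a k i * e₂ k n = 0 := by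
  rw [← a_mul_e₁, mul_assoc, e₁_mul_e₂, mul_zero]

@[simp] theorem e₁_mul_b (i : Fin n) : e₁ k n * b k i = b k i := by
  rw [← e₁_mul_b_mul_e₂, ← mul_assoc, ← mul_assoc, e₁_mul_e₁]

@[simp] theorem b_mul_e₂ (i : Fin n) : b k i * e₂ k n = b k i := by
  rw [← e₁_mul_b_mul_e₂, mul_assoc, e₂_mul_e₂]

@[simp] theorem e₂_mul_b (i : Fin n) : e₂ k n * b k i = 0 := by
  rw [← e₁_mul_b, ← mul_assoc, e₂_mul_e₁, zero_mul]

@[simp] theorem b_mul_e₁ (i : Fin n) : b k i * e₁ k n = 0 := by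
  rw [← b_mul_e₂, mul_assoc, e₂_mul_e₁, mul_zero]

@[simp] theorem a_mul_a (i j : Fin n) : a k i * a k j = 0 := by
  rw [← a_mul_e₁, mul_assoc, e₁_mul_a, mul_zero]

@[simp] theorem b_mul_b (i j : Fin n) : b k i * b k j = 0 := by
  rw [← b_mul_e₂, mul_assoc, e₂_mul_b, mul_zero]

variable (k n) in
/-- The inverse `(a_1, b_1, …, a_n, b_n)⁻¹` in `e₂ B(Γ_n) e₂`. -/
def contAInv : BoalchAlgebra k n := mk k n (gen k n .invA)

@[simp] theorem e₂_mul_contAInv : e₂ k n * contAInv k n = contAInv k n := by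
  simpa [e₂, contAInv] using mk_eq_mk (.e₂_invA (k := k) (n := n))

@[simp] theorem contAInv_mul_e₂ : contAInv k n * e₂ k n = contAInv k n := by
  simpa [e₂, contAInv] using mk_eq_mk (.invA_e₂ (k := k) (n := n))

@[simp] theorem e₁_mul_contBInv : e₁ k n * contBInv k n = contBInv k n := by
  simpa [e₁, contBInv] using mk_eq_mk (.e₁_invB (k := k) (n := n))

@[simp] theorem contBInv_mul_e₁ : contBInv k n * e₁ k n = contBInv k n := by
  simpa [e₁, contBInv] using mk_eq_mk (.invB_e₁ (k := k) (n := n))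

@[simp] theorem e₁_mul_contAInv : e₁ k n * contAInv k n = 0 := by
  rw [← e₂_mul_contAInv, ← mul_assoc, e₁_mul_e₂, zero_mul]

@[simp] theorem contAInv_mul_e₁ : contAInv k n * e₁ k n = 0 := by
  rw [← contAInv_mul_e₂, mul_assoc, e₂_mul_e₁, mul_zero]

@[simp] theorem e₂_mul_contBInv : e₂ k n * contBInv k n = 0 := by
  rw [← e₁_mul_contBInv, ← mul_assoc, e₂_mul_e₁, zero_mul]

@[simp] theorem contBInv_mul_e₂ : contBInv k n * e₂ k n = 0 := by
  rw [← contBInv_mul_e₁, mul_assoc, e₁_mul_e₂, mul_zero]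

@[simp] theorem contAInv_mul_contBInv : contAInv k n * contBInv k n = 0 := by
  rw [← contAInv_mul_e₂, mul_assoc, e₂_mul_contBInv, mul_zero]

@[simp] theorem contBInv_mul_contAInv : contBInv k n * contAInv k n = 0 := by
  rw [← contBInv_mul_e₁, mul_assoc, e₁_mul_contAInv, mul_zero]

theorem contAInv_mul_mk : contAInv k n * mk k n (freeContA k n) = e₂ k n := by
  simpa [e₂, contAInv] using mk_eq_mk (.invA_mul (k := k) (n := n))

theorem mk_mul_contAInv : mk k n (freeContA k n) * contAInv k n = e₂ k n := by
  simpa [e₂, contAInv] using mk_eq_mk (.mul_invA (k := k) (n := n))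

theorem contBInv_mul_mk : contBInv k n * mk k n (freeContB k n) = e₁ k n := by
  simpa [e₁, contBInv] using mk_eq_mk (.invB_mul (k := k) (n := n))

theorem mk_mul_contBInv : mk k n (freeContB k n) * contBInv k n = e₁ k n := by
  simpa [e₁, contBInv] using mk_eq_mk (.mul_invB (k := k) (n := n))

variable (k n) in
/-- The bracket of an arrow `x` at position `p` with a generator. -/
def arrowBracket (p : ℕ) (x : BoalchAlgebra k n) :
    BoalchGen n → BoalchAlgebra k n ⊗[k] BoalchAlgebra k n
  | .e₁ => 0
  | .e₂ => 0
  | .a j => letterBracket p (2 * j) (e₂ k n) (e₁ k n) x (a k j)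
  | .b j => letterBracket p (2 * j + 1) (e₁ k n) (e₂ k n) x (b k j)
  | .invA => -momentBracket (e₂ k n) (contAInv k n) x
  | .invB => momentBracket (e₁ k n) (contBInv k n) x

variable (k n) in
/-- The bracket of two generators. The arrow `a_i` has position `2 i`, the arrow `b_i` has
position `2 i + 1`, and the inverses of the continuants act as components of a moment map. -/
def genBracket : BoalchGen n → BoalchGen n → BoalchAlgebra k n ⊗[k] BoalchAlgebra k n
  | .e₁, _ => 0
  | .e₂, _ => 0
  | .a i, z => arrowBracket k n (2 * i) (a k i) z
  | .b i, z => arrowBracket k n (2 * i + 1) (b k i) z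
  | .invA, z => TensorProduct.comm k _ _
      (momentBracket (e₂ k n) (contAInv k n) (mk k n (gen k n z)))
  | .invB, z => -TensorProduct.comm k _ _
      (momentBracket (e₁ k n) (contBInv k n) (mk k n (gen k n z)))

theorem adjSign_of_mod_eq {p q : ℕ} (h : p % 2 = q % 2) : adjSign k p q = 0 := by
  unfold adjSign
  rw [if_neg (by omega), if_neg (by omega)]

theorem letterBracket_a_a (p q : ℕ) (h : p % 2 = q % 2) (i j : Fin n) :
    letterBracket p q (e₂ k n) (e₁ k n) (a k i) (a k j)
      = (posSign k p q / 2) • (a k i ⊗ₜ[k] a k j + a k j ⊗ₜ[k] a k i) := by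
  simp [letterBracket, adjSign_of_mod_eq h]

theorem letterBracket_b_b (p q : ℕ) (h : p % 2 = q % 2) (i j : Fin n) :
    letterBracket p q (e₁ k n) (e₂ k n) (b k i) (b k j)
      = (posSign k p q / 2) • (b k i ⊗ₜ[k] b k j + b k j ⊗ₜ[k] b k i) := by
  simp [letterBracket, adjSign_of_mod_eq h]

theorem letterBracket_a_b (p q : ℕ) (i j : Fin n) :
    letterBracket p q (e₁ k n) (e₂ k n) (a k i) (b k j)
      = -(posSign k p q / 2) • (e₁ k n ⊗ₜ[k] (a k i * b k j) + (b k j * a k i) ⊗ₜ[k] e₂ k n)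
        + adjSign k p q • e₁ k n ⊗ₜ[k] e₂ k n := by
  simp only [letterBracket, e₁_mul_a, a_mul_e₂, TensorProduct.zero_tmul, TensorProduct.tmul_zero]
  module

theorem letterBracket_b_a (p q : ℕ) (i j : Fin n) :
    letterBracket p q (e₂ k n) (e₁ k n) (b k i) (a k j)
      = -(posSign k p q / 2) • (e₂ k n ⊗ₜ[k] (b k i * a k j) + (a k j * b k i) ⊗ₜ[k] e₁ k n)
        + adjSign k p q • e₂ k n ⊗ₜ[k] e₁ k n := by
  simp only [letterBracket, e₂_mul_b, b_mul_e₁, TensorProduct.zero_tmul, TensorProduct.tmul_zero]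
  module

theorem comm_comm (t : BoalchAlgebra k n ⊗[k] BoalchAlgebra k n) :
    TensorProduct.comm k _ _ (TensorProduct.comm k _ _ t) = t :=
  (TensorProduct.comm k _ _).symm_apply_apply t

theorem genBracket_antisymm (x y : BoalchGen n) :
    genBracket k n x y = -TensorProduct.comm k _ _ (genBracket k n y x) := by
  have hA1 : momentBracket (k := k) (e₂ k n) (contAInv k n) (e₁ k n) = 0 := by
    simp [momentBracket]
  have hA2 : momentBracket (k := k) (e₂ k n) (contAInv k n) (e₂ k n) = 0 := by
    simp [momentBracket]
  have hB1 : momentBracket (k := k) (e₁ k n) (contBInv k n) (e₁ k n) = 0 := by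
    simp [momentBracket]
  have hB2 : momentBracket (k := k) (e₁ k n) (contBInv k n) (e₂ k n) = 0 := by
    simp [momentBracket]
  have hAB : momentBracket (k := k) (e₁ k n) (contBInv k n) (contAInv k n) = 0 := by
    simp [momentBracket]
  have hBA : momentBracket (k := k) (e₂ k n) (contAInv k n) (contBInv k n) = 0 := by
    simp [momentBracket]
  have hA : ∀ f φ : BoalchAlgebra k n, f * φ = φ → φ * f = φ →
      TensorProduct.comm k _ _ (momentBracket (k := k) f φ φ) = -momentBracket f φ φ := by
    intro f φ h1 h2
    simp [momentBracket, h1, h2]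
    module
  have h0 : TensorProduct.comm k (BoalchAlgebra k n) (BoalchAlgebra k n) 0 = 0 :=
    map_zero _
  have r1 : mk k n (gen k n .e₁) = e₁ k n := rfl
  have r2 : mk k n (gen k n .e₂) = e₂ k n := rfl
  have rA : mk k n (gen k n .invA) = contAInv k n := rfl
  have rB : mk k n (gen k n .invB) = contBInv k n := rfl
  have ra : ∀ i, mk k n (gen k n (.a i)) = a k i := fun _ => rfl
  have rb : ∀ i, mk k n (gen k n (.b i)) = b k i := fun _ => rfl
  cases x <;> cases y <;> simp only [genBracket, arrowBracket, comm_comm, map_neg, neg_neg, h0,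
    neg_zero, r1, r2, rA, rB, ra, rb, hA1, hA2, hB1, hB2, hAB, hBA]
  · rw [letterBracket_a_a _ _ (by omega), letterBracket_a_a _ _ (by omega), posSign_swap]
    simp only [map_add, map_smul, TensorProduct.comm_tmul]
    module
  · rw [letterBracket_a_b, letterBracket_b_a, posSign_swap, adjSign_swap]
    simp only [map_add, map_smul, TensorProduct.comm_tmul]
    module
  · rw [letterBracket_b_a, letterBracket_a_b, posSign_swap, adjSign_swap]
    simp only [map_add, map_smul, TensorProduct.comm_tmul]
    module
  · rw [letterBracket_b_b _ _ (by omega), letterBracket_b_b _ _ (by omega), posSign_swap]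
    simp only [map_add, map_smul, TensorProduct.comm_tmul]
    module
  · exact hA _ _ e₂_mul_contAInv contAInv_mul_e₂
  · rw [hA _ _ e₁_mul_contBInv contBInv_mul_e₁, neg_neg]

end BoalchAlgebra

/-! ### The brackets of letters with the two continuants -/

section InnerDerivations

variable {k : Type*} [Field k] {A X : Type*} [Ring A] [Algebra k A]

/-- A derivation given on generators by an inner derivation is that inner derivation. -/
theorem outerDerivation_inner (π : FreeAlgebra k X →ₐ[k] A) (W : A ⊗[k] A) (f : X → A ⊗[k] A)
    (hf : ∀ x, f x = W * (1 ⊗ₜ[k] π (FreeAlgebra.ι k x)) - (π (FreeAlgebra.ι k x) ⊗ₜ[k] 1) * W)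
    (z : FreeAlgebra k X) :
    outerDerivation π f z = W * (1 ⊗ₜ[k] π z) - (π z ⊗ₜ[k] 1) * W := by
  induction z using FreeAlgebra.induction with
  | grade0 c =>
    rw [Algebra.algebraMap_eq_smul_one, map_smul, outerDerivation_one, map_smul, map_one,
      TensorProduct.tmul_smul, ← TensorProduct.smul_tmul', ← Algebra.TensorProduct.one_def]
    simp
  | grade1 x => rw [outerDerivation_ι, hf]
  | mul a b ha hb =>
    have h2 : (1 : A) ⊗ₜ[k] (π a * π b) = (1 ⊗ₜ[k] π a) * (1 ⊗ₜ[k] π b) := by simp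
    have h3 : (π a * π b) ⊗ₜ[k] (1 : A) = (π a ⊗ₜ[k] 1) * (π b ⊗ₜ[k] 1) := by simp
    rw [outerDerivation_mul, ha, hb, map_mul, h2, h3]
    noncomm_ring
  | add a b ha hb =>
    rw [map_add, ha, hb, map_add, TensorProduct.tmul_add, TensorProduct.add_tmul, mul_add, add_mul]
    abel

end InnerDerivations

namespace BoalchAlgebra

variable {k : Type*} [Field k] {n : ℕ}

theorem outerDerivation_invA (z : FreeAlgebra k (BoalchGen n)) :
    outerDerivation (mk k n) (genBracket k n .invA) z =
      TensorProduct.comm k _ _ (momentBracket (e₂ k n) (contAInv k n) (mk k n z)) := by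
  rw [comm_momentBracket]
  exact outerDerivation_inner _ _ _ (fun x => comm_momentBracket _ _ _) z

theorem outerDerivation_invB (z : FreeAlgebra k (BoalchGen n)) :
    outerDerivation (mk k n) (genBracket k n .invB) z =
      -TensorProduct.comm k _ _ (momentBracket (e₁ k n) (contBInv k n) (mk k n z)) := by
  rw [comm_momentBracket]
  refine (outerDerivation_inner _
    (-((1 / 2 : k) • (contBInv k n ⊗ₜ[k] e₁ k n + e₁ k n ⊗ₜ[k] contBInv k n))) _
    (fun x => ?_) z).trans ?_
  · refine (congrArg Neg.neg (comm_momentBracket (k := k) _ _ _)).trans ?_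
    rw [neg_mul, mul_neg]
    abel
  · rw [neg_mul, mul_neg]
    abel

variable (k n) in
/-- The `p`-th letter of the word `a_1, b_1, …, a_n, b_n`, counted from `0`; it is `0` past the
end. -/
def letter (p : ℕ) : FreeAlgebra k (BoalchGen n) :=
  if h : p / 2 < n then
    if p % 2 = 0 then gen k n (.a ⟨p / 2, h⟩) else gen k n (.b ⟨p / 2, h⟩)
  else 0

variable (k n) in
/-- The idempotent at the head of the `p`-th letter. -/
def letterHead (p : ℕ) : BoalchAlgebra k n := if p % 2 = 0 then e₂ k n else e₁ k n

theorem letterHead_even {p : ℕ} (h : p % 2 = 0) : letterHead k n p = e₂ k n := if_pos h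

theorem letterHead_odd {p : ℕ} (h : p % 2 = 1) : letterHead k n p = e₁ k n :=
  if_neg (by omega)

theorem letterHead_eq {p q : ℕ} (h : p % 2 = q % 2) : letterHead k n p = letterHead k n q := by
  rw [letterHead, letterHead, h]

theorem letterHead_mul_self (p : ℕ) : letterHead k n p * letterHead k n p = letterHead k n p := by
  unfold letterHead
  split_ifs <;> simp

theorem letterHead_mul_succ (p : ℕ) : letterHead k n p * letterHead k n (p + 1) = 0 := by
  rcases Nat.mod_two_eq_zero_or_one p with h | h
  · rw [letterHead_even h, letterHead_odd (by omega), e₂_mul_e₁]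
  · rw [letterHead_odd h, letterHead_even (by omega), e₁_mul_e₂]

theorem letter_two_mul (i : Fin n) : letter k n (2 * i) = gen k n (.a i) := by
  have h2 : 2 * (i : ℕ) % 2 = 0 := by omega
  simp [letter, h2]

theorem letter_two_mul_add_one (i : Fin n) : letter k n (2 * i + 1) = gen k n (.b i) := by
  have h : (2 * (i : ℕ) + 1) / 2 = i := by omega
  have h2 : (2 * (i : ℕ) + 1) % 2 = 1 := by omega
  simp [letter, h, h2]

theorem exists_letter_eq {p : ℕ} (hp : p < 2 * n) :
    (∃ i : Fin n, p = 2 * i) ∨ ∃ i : Fin n, p = 2 * i + 1 := by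
  rcases Nat.mod_two_eq_zero_or_one p with h | h
  · exact .inl ⟨⟨p / 2, by omega⟩, by simp only; omega⟩
  · exact .inr ⟨⟨p / 2, by omega⟩, by simp only; omega⟩

theorem mk_letter_two_mul (i : Fin n) : mk k n (letter k n (2 * i)) = a k i := by
  rw [letter_two_mul]; rfl

theorem mk_letter_two_mul_add_one (i : Fin n) : mk k n (letter k n (2 * i + 1)) = b k i := by
  rw [letter_two_mul_add_one]; rfl

theorem letter_of_le {p : ℕ} (hp : 2 * n ≤ p) : letter k n p = 0 := by
  rw [letter, dif_neg (by omega)]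

theorem letterHead_mul_letter (p : ℕ) :
    letterHead k n p * mk k n (letter k n p) = mk k n (letter k n p) := by
  rcases lt_or_ge p (2 * n) with hp | hp
  · obtain ⟨i, rfl⟩ | ⟨i, rfl⟩ := exists_letter_eq hp
    · rw [letterHead_even (by omega), mk_letter_two_mul, e₂_mul_a]
    · rw [letterHead_odd (by omega), mk_letter_two_mul_add_one, e₁_mul_b]
  · rw [letter_of_le hp, map_zero, mul_zero]

theorem letter_mul_letterHead (p : ℕ) :
    mk k n (letter k n p) * letterHead k n (p + 1) = mk k n (letter k n p) := by
  rcases lt_or_ge p (2 * n) with hp | hp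
  · obtain ⟨i, rfl⟩ | ⟨i, rfl⟩ := exists_letter_eq hp
    · rw [letterHead_odd (by omega), mk_letter_two_mul, a_mul_e₁]
    · rw [letterHead_even (by omega), mk_letter_two_mul_add_one, b_mul_e₂]
  · rw [letter_of_le hp, map_zero, zero_mul]

theorem freeContA_eq : freeContA k n = prefixContinuant (gen k n .e₂) (letter k n) (2 * n) := by
  rw [freeContA, prefixContinuant,
    alternatingWord_eq_map_range letter_two_mul letter_two_mul_add_one]

variable (k n) in
/-- The `p`-th letter of the word read backwards; as for `letter`, it is `0` past the end. -/
def revLetter (p : ℕ) : FreeAlgebra k (BoalchGen n) :=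
  if p < 2 * n then letter k n (2 * n - 1 - p) else 0

theorem revLetter_of_lt {p : ℕ} (hp : p < 2 * n) :
    revLetter k n p = letter k n (2 * n - 1 - p) := if_pos hp

theorem letterHead_mul_revLetter (q : ℕ) :
    letterHead k n (q + 1) * mk k n (revLetter k n q) = mk k n (revLetter k n q) := by
  rcases lt_or_ge q (2 * n) with hq | hq
  · rw [revLetter_of_lt hq, letterHead_eq (q := 2 * n - 1 - q) (by omega)]
    exact letterHead_mul_letter _
  · rw [revLetter, if_neg (by omega), map_zero, mul_zero]

theorem revLetter_mul_letterHead (q : ℕ) :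
    mk k n (revLetter k n q) * letterHead k n (q + 1 + 1) = mk k n (revLetter k n q) := by
  rcases lt_or_ge q (2 * n) with hq | hq
  · rw [revLetter_of_lt hq, letterHead_eq (q := 2 * n - 1 - q + 1) (by omega)]
    exact letter_mul_letterHead _
  · rw [revLetter, if_neg (by omega), map_zero, zero_mul]

theorem freeContB_eq : freeContB k n = prefixContinuant (gen k n .e₁) (revLetter k n) (2 * n) := by
  rw [freeContB, prefixContinuant,
    alternatingWord_eq_map_range letter_two_mul letter_two_mul_add_one]
  congr 1
  apply List.ext_getElem
  · simp
  · intro i h1 h2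
    have hi : i < 2 * n := by simpa using h2
    simp [revLetter_of_lt hi]

theorem letterBracket_rev (m p q : ℕ) (hp : p < m) (hq : q < m) (u v x y : BoalchAlgebra k n) :
    letterBracket (m - 1 - p) (m - 1 - q) u v x y = -letterBracket (k := k) p q u v x y := by
  have h1 : posSign k (m - 1 - p) (m - 1 - q) = -posSign k p q := by
    unfold posSign
    split_ifs <;> first | omega | simp
  have h2 : adjSign k (m - 1 - p) (m - 1 - q) = -adjSign k p q := by
    unfold adjSign
    split_ifs <;> first | omega | simp
  rw [letterBracket, letterBracket, h1, h2]
  module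

theorem e₂_mul_mk_freeContA : e₂ k n * mk k n (freeContA k n) = mk k n (freeContA k n) := by
  rw [freeContA_eq]
  exact head_mul_prefixContinuant (h := letterHead k n) letterHead_mul_self letterHead_mul_letter
    rfl _

theorem mk_freeContA_mul_e₂ : mk k n (freeContA k n) * e₂ k n = mk k n (freeContA k n) := by
  rw [freeContA_eq, ← letterHead_even (p := 2 * n) (by omega)]
  exact prefixContinuant_mul_tail (h := letterHead k n) (fun q => letterHead_eq (by omega))
    letterHead_mul_self letter_mul_letterHead rfl _

theorem e₁_mul_mk_freeContB : e₁ k n * mk k n (freeContB k n) = mk k n (freeContB k n) := by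
  rw [freeContB_eq]
  exact head_mul_prefixContinuant (h := fun q => letterHead k n (q + 1))
    (fun q => letterHead_mul_self _) letterHead_mul_revLetter rfl _

theorem mk_freeContB_mul_e₁ : mk k n (freeContB k n) * e₁ k n = mk k n (freeContB k n) := by
  rw [freeContB_eq, ← letterHead_odd (p := 2 * n + 1) (by omega)]
  exact prefixContinuant_mul_tail (h := fun q => letterHead k n (q + 1))
    (fun q => letterHead_eq (by omega)) (fun q => letterHead_mul_self _) revLetter_mul_letterHead
    rfl _

variable (k n) in
/-- The derivation `⦃x, -⦄` of the free algebra attached to the `p`-th letter `x`. -/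
def letterDerivation (p : ℕ) :
    FreeAlgebra k (BoalchGen n) →ₗ[k] BoalchAlgebra k n ⊗[k] BoalchAlgebra k n :=
  outerDerivation (mk k n) (arrowBracket k n p (mk k n (letter k n p)))

theorem letterDerivation_letter (p : ℕ) {q : ℕ} (hq : q < 2 * n) :
    letterDerivation k n p (letter k n q) = letterBracket p q (letterHead k n q)
      (letterHead k n (q + 1)) (mk k n (letter k n p)) (mk k n (letter k n q)) := by
  obtain ⟨i, rfl⟩ | ⟨i, rfl⟩ := exists_letter_eq hq
  · rw [letterHead_even (by omega), letterHead_odd (by omega), mk_letter_two_mul, letter_two_mul,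
      letterDerivation, outerDerivation_ι, arrowBracket]
  · rw [letterHead_odd (by omega), letterHead_even (by omega), mk_letter_two_mul_add_one,
      letter_two_mul_add_one, letterDerivation, outerDerivation_ι, arrowBracket]

theorem letterDerivation_mul (p : ℕ) (u v : FreeAlgebra k (BoalchGen n)) :
    letterDerivation k n p (u * v) = letterDerivation k n p u * (1 ⊗ₜ[k] mk k n v)
      + (mk k n u ⊗ₜ[k] 1) * letterDerivation k n p v := outerDerivation_mul ..

variable [CharZero k]

theorem letterDerivation_freeContA {p : ℕ} (hp : p < 2 * n) :
    letterDerivation k n p (freeContA k n) =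
      momentBracket (e₂ k n) (mk k n (freeContA k n)) (mk k n (letter k n p)) := by
  rw [freeContA_eq]
  refine derivation_prefixContinuant (h := letterHead k n) (letterDerivation_mul p) hp
    (fun q => letterHead_eq (by omega)) letterHead_mul_self letterHead_mul_succ
    letterHead_mul_letter letter_mul_letterHead rfl (outerDerivation_ι ..)
    (letterHead_eq (by omega)) (fun q hq => letterDerivation_letter p hq)

/-- Reversing the word changes the sign of all brackets of letters, so that the reversed continuant
satisfies the moment map condition for the opposite bracket. -/
theorem letterDerivation_freeContB {p : ℕ} (hp : p < 2 * n) :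
    letterDerivation k n p (freeContB k n) =
      -momentBracket (e₁ k n) (mk k n (freeContB k n)) (mk k n (letter k n p)) := by
  have hlt : ∀ q, q < 2 * n → 2 * n - 1 - q < 2 * n := fun q hq => by omega
  have hp' : 2 * n - 1 - p < 2 * n := hlt p hp
  have hpp : 2 * n - 1 - (2 * n - 1 - p) = p := by omega
  have hx : revLetter k n (2 * n - 1 - p) = letter k n p := by rw [revLetter_of_lt hp', hpp]
  have key := derivation_prefixContinuant (d := -letterDerivation k n p) (π := mk k n)
    (h := fun q => letterHead k n (q + 1)) (w := revLetter k n) (e := gen k n .e₁)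
    (p := 2 * n - 1 - p) (m := 2 * n) (fun u v => ?_) hp'
    (fun q => letterHead_eq (by omega)) (fun q => letterHead_mul_self _)
    (fun q => letterHead_mul_succ _) letterHead_mul_revLetter revLetter_mul_letterHead rfl
    (by rw [LinearMap.neg_apply, letterDerivation, outerDerivation_ι, arrowBracket, neg_zero])
    (letterHead_eq (by omega)) (fun q hq => ?_)
  · rw [freeContB_eq, ← hx, ← neg_eq_iff_eq_neg]
    exact key
  · simp only [LinearMap.neg_apply, letterDerivation_mul, neg_mul, mul_neg]
    abel
  · rw [LinearMap.neg_apply, revLetter_of_lt hq, letterDerivation_letter _ (hlt q hq), hx,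
      letterHead_eq (p := 2 * n - 1 - q) (q := q + 1) (by omega),
      letterHead_eq (p := 2 * n - 1 - q + 1) (q := q + 1 + 1) (by omega), neg_eq_iff_eq_neg]
    have := letterBracket_rev (k := k) (2 * n) (2 * n - 1 - p) q hp' hq (letterHead k n (q + 1))
      (letterHead k n (q + 1 + 1)) (mk k n (letter k n p)) (mk k n (letter k n (2 * n - 1 - q)))
    rwa [hpp] at this

end BoalchAlgebra

/-! ### Existence of the double bracket -/

theorem mul_letterBracket_mul {k : Type*} [Field k] {A : Type*} [Ring A] [Algebra k A] (p q : ℕ)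
    {u v x y : A} (uu : u * u = u) (vv : v * v = v) (uy : u * y = y) (yv : y * v = y) :
    (u ⊗ₜ[k] 1) * letterBracket p q u v x y * (1 ⊗ₜ[k] v) = letterBracket (k := k) p q u v x y := by
  simp only [letterBracket, mul_add, mul_sub, mul_smul_comm, add_mul, sub_mul, smul_mul_assoc,
    Algebra.TensorProduct.tmul_mul_tmul, one_mul, mul_one, ← mul_assoc, uu, uy]
  simp only [mul_assoc, vv, yv]

namespace BoalchAlgebra

variable {k : Type*} [Field k] [CharZero k] {n : ℕ}

/-- The bracket with a letter respects the relations of the Boalch algebra. For the relations that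
invert the continuants this is the moment map condition. -/
theorem letterDerivation_eq_of_rel {p : ℕ} (hp : p < 2 * n) {u v : FreeAlgebra k (BoalchGen n)}
    (h : BoalchRel k n u v) : letterDerivation k n p u = letterDerivation k n p v := by
  have d1 : letterDerivation k n p (gen k n .e₁) = 0 := outerDerivation_ι ..
  have d2 : letterDerivation k n p (gen k n .e₂) = 0 := outerDerivation_ι ..
  have da : ∀ i, letterDerivation k n p (gen k n (.a i)) = letterBracket p (2 * i) (e₂ k n)
      (e₁ k n) (mk k n (letter k n p)) (a k i) := fun i => outerDerivation_ι ..
  have db : ∀ i, letterDerivation k n p (gen k n (.b i)) = letterBracket p (2 * i + 1) (e₁ k n)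
      (e₂ k n) (mk k n (letter k n p)) (b k i) := fun i => outerDerivation_ι ..
  have dA : letterDerivation k n p (gen k n .invA) =
      -momentBracket (e₂ k n) (contAInv k n) (mk k n (letter k n p)) := outerDerivation_ι ..
  have dB : letterDerivation k n p (gen k n .invB) =
      momentBracket (e₁ k n) (contBInv k n) (mk k n (letter k n p)) := outerDerivation_ι ..
  have done : letterDerivation k n p 1 = 0 := outerDerivation_one ..
  have m1 : mk k n (gen k n .e₁) = e₁ k n := rfl
  have m2 : mk k n (gen k n .e₂) = e₂ k n := rfl
  have mA : mk k n (gen k n .invA) = contAInv k n := rfl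
  have mB : mk k n (gen k n .invB) = contBInv k n := rfl
  cases h with
  | one => rw [map_add, d1, d2, done, add_zero]
  | e₁_e₁ => rw [letterDerivation_mul, d1, zero_mul, mul_zero, add_zero]
  | e₂_e₂ => rw [letterDerivation_mul, d2, zero_mul, mul_zero, add_zero]
  | e₁_e₂ => rw [letterDerivation_mul, d1, d2, zero_mul, mul_zero, add_zero, map_zero]
  | e₂_e₁ => rw [letterDerivation_mul, d1, d2, zero_mul, mul_zero, add_zero, map_zero]
  | a i =>
    rw [letterDerivation_mul, letterDerivation_mul, d1, d2, zero_mul, mul_zero, add_zero, zero_add,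
      da, m1, m2, mul_letterBracket_mul _ _ e₂_mul_e₂ e₁_mul_e₁ (e₂_mul_a i) (a_mul_e₁ i)]
  | b i =>
    rw [letterDerivation_mul, letterDerivation_mul, d1, d2, zero_mul, mul_zero, add_zero, zero_add,
      db, m1, m2, mul_letterBracket_mul _ _ e₁_mul_e₁ e₂_mul_e₂ (e₁_mul_b i) (b_mul_e₂ i)]
  | e₂_invA =>
    rw [letterDerivation_mul, d2, zero_mul, zero_add, dA, m2, mul_neg]
    simp [momentBracket, mul_add, mul_sub, ← mul_assoc]
  | invA_e₂ =>
    rw [letterDerivation_mul, d2, mul_zero, add_zero, dA, m2, neg_mul]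
    simp [momentBracket, add_mul, sub_mul, mul_assoc]
  | e₁_invB =>
    rw [letterDerivation_mul, d1, zero_mul, zero_add, dB, m1]
    simp [momentBracket, mul_add, mul_sub, ← mul_assoc]
  | invB_e₁ =>
    rw [letterDerivation_mul, d1, mul_zero, add_zero, dB, m1]
    simp [momentBracket, add_mul, sub_mul, mul_assoc]
  | invA_mul =>
    rw [letterDerivation_mul, d2, dA, mA, letterDerivation_freeContA hp, neg_mul,
      momentBracket_mul_right e₂_mul_mk_freeContA contAInv_mul_mk, mul_momentBracket contAInv_mul_e₂
        contAInv_mul_mk, neg_add_cancel]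
  | mul_invA =>
    rw [letterDerivation_mul, d2, dA, mA, letterDerivation_freeContA hp, mul_neg,
      momentBracket_mul_right e₂_mul_contAInv mk_mul_contAInv, mul_momentBracket mk_freeContA_mul_e₂
        mk_mul_contAInv, add_neg_cancel]
  | invB_mul =>
    rw [letterDerivation_mul, d1, dB, mB, letterDerivation_freeContB hp, mul_neg,
      momentBracket_mul_right e₁_mul_mk_freeContB contBInv_mul_mk, mul_momentBracket contBInv_mul_e₁
        contBInv_mul_mk, add_neg_cancel]
  | mul_invB =>
    rw [letterDerivation_mul, d1, dB, mB, letterDerivation_freeContB hp, neg_mul,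
      momentBracket_mul_right e₁_mul_contBInv mk_mul_contBInv, mul_momentBracket mk_freeContB_mul_e₁
        mk_mul_contBInv, neg_add_cancel]

theorem outerDerivation_genBracket_eq_zero (x : BoalchGen n) {z : FreeAlgebra k (BoalchGen n)}
    (hz : mk k n z = 0) : outerDerivation (mk k n) (genBracket k n x) z = 0 := by
  have h0 : TensorProduct.comm k (BoalchAlgebra k n) (BoalchAlgebra k n) 0 = 0 := map_zero _
  have hm : ∀ f φ : BoalchAlgebra k n, momentBracket (k := k) f φ 0 = 0 := by simp [momentBracket]
  have hp : ∀ {p : ℕ}, p < 2 * n → letterDerivation k n p z = 0 := fun {p} hp =>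
    (isTwistedDerivation_freeDerivation ((outerLeft k _).comp (mk k n))
      ((outerRight k _).comp (mk k n)) (arrowBracket k n p
        (mk k n (letter k n p)))).eq_zero_of_mkAlgHom
      (fun u v h => congrArg (outerLeft k _) (mk_eq_mk h))
      (fun u v h => congrArg (outerRight k _) (mk_eq_mk h))
      (fun u v h => letterDerivation_eq_of_rel hp h) hz
  have he : outerDerivation (mk k n) (fun _ => 0) z = 0 := by
    rw [outerDerivation_inner _ 0 _ (fun x => by simp)]
    simp
  cases x with
  | e₁ => exact he
  | e₂ => exact he
  | a i =>
    have := hp (p := 2 * i) (by omega)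
    rwa [letterDerivation, mk_letter_two_mul] at this
  | b i =>
    have := hp (p := 2 * i + 1) (by omega)
    rwa [letterDerivation, mk_letter_two_mul_add_one] at this
  | invA => rw [outerDerivation_invA, hz, hm, h0]
  | invB => rw [outerDerivation_invB, hz, hm, h0, neg_zero]

/-- The double bracket on the Boalch algebra, described by the derivations attached to the
generators. -/
theorem exists_doubleBracket_genBracket : ∃ D : DoubleBracket k (idem k n),
    ∀ x z, D.toFun (mk k n (gen k n x)) (mk k n z)
      = outerDerivation (mk k n) (genBracket k n x) z := by
  have hidem : idem k n = fun s => mk k n (gen k n (![.e₁, .e₂] s)) := by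
    ext s
    fin_cases s <;> rfl
  rw [hidem]
  obtain ⟨D, hD⟩ := exists_doubleBracket (mk k n) (genBracket k n) mk_surjective
    genBracket_antisymm (fun x z => outerDerivation_genBracket_eq_zero x) ![.e₁, .e₂] (by
      intro s y
      fin_cases s <;> rfl)
  exact ⟨D, fun x z => by rw [hD, freeBracket_ι]⟩

theorem isEulerBracket_of_genBracket {D : DoubleBracket k (idem k n)}
    (hD : ∀ x y, D.toFun (mk k n (gen k n x)) (mk k n (gen k n y)) = genBracket k n x y) :
    IsEulerBracket D := by
  have haa : ∀ i j, D.toFun (a k i) (a k j) =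
      (posSign k (2 * i) (2 * j) / 2) • (a k i ⊗ₜ[k] a k j + a k j ⊗ₜ[k] a k i) := fun i j =>
    (hD (.a i) (.a j)).trans (letterBracket_a_a _ _ (by omega) i j)
  have hbb : ∀ i j, D.toFun (b k i) (b k j) =
      (posSign k (2 * i + 1) (2 * j + 1) / 2) • (b k i ⊗ₜ[k] b k j + b k j ⊗ₜ[k] b k i) :=
    fun i j => (hD (.b i) (.b j)).trans (letterBracket_b_b _ _ (by omega) i j)
  have hab : ∀ i j, D.toFun (a k i) (b k j) = _ := fun i j =>
    (hD (.a i) (.b j)).trans (letterBracket_a_b _ _ i j)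
  have hba : ∀ i j, D.toFun (b k i) (a k j) = _ := fun i j =>
    (hD (.b i) (.a j)).trans (letterBracket_b_a _ _ i j)
  constructor
  · intro i j h
    rw [haa, posSign, if_pos (by omega)]
    module
  · intro i
    rw [haa, posSign, if_neg (by omega), if_pos rfl, zero_div, zero_smul]
  · intro i j h
    rw [haa, posSign, if_neg (by omega), if_neg (by omega)]
  · intro i j h
    rw [hbb, posSign, if_pos (by omega)]
    module
  · intro i
    rw [hbb, posSign, if_neg (by omega), if_pos rfl, zero_div, zero_smul]
  · intro i j h
    rw [hbb, posSign, if_neg (by omega), if_neg (by omega)]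
  · intro i j h
    rw [hab, posSign, if_pos (by omega), adjSign, if_neg (by omega), if_neg (by omega)]
    module
  · intro i
    rw [hab, posSign, if_pos (by omega), adjSign, if_pos (by omega)]
    module
  · intro i j h
    rw [hab, posSign, if_neg (by omega), if_neg (by omega), adjSign, if_neg (by omega)]
    have : (2 * (i : ℕ) = 2 * j + 1 + 1) ↔ (i : ℕ) = j + 1 := by omega
    simp only [this]
    split_ifs <;> module
  · intro i j h
    rw [hba, posSign, if_pos (by omega), adjSign,
      if_neg (show ¬ 2 * (i : ℕ) + 1 = 2 * j + 1 by omega)]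
    have : (2 * (j : ℕ) = 2 * i + 1 + 1) ↔ (j : ℕ) = i + 1 := by omega
    simp only [this]
    split_ifs <;> module
  · intro i
    rw [hba, posSign, if_neg (by omega), if_neg (by omega), adjSign, if_neg (by omega),
      if_pos rfl]
    module
  · intro i j h
    rw [hba, posSign, if_neg (by omega), if_neg (by omega), adjSign, if_neg (by omega),
      if_neg (by omega)]
    module

end BoalchAlgebra

/-! ### Uniqueness of the double bracket -/

namespace DoubleBracket

variable {k : Type*} [Field k] {A : Type*} [Ring A] [Algebra k A] {I : Type*} {e : I → A}
  (D : DoubleBracket k e)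

theorem isTwistedDerivation (x : A) :
    IsTwistedDerivation (outerLeft k A) (outerRight k A) (D.toFun x) :=
  D.leibniz x

theorem toFun_injective {D D' : DoubleBracket k e} (h : ∀ x y, D.toFun x y = D'.toFun x y) :
    D = D' := by
  obtain ⟨f, _, _, _⟩ := D
  obtain ⟨g, _, _, _⟩ := D'
  obtain rfl : f = g := LinearMap.ext fun x => LinearMap.ext fun y => h x y
  rfl

end DoubleBracket

namespace BoalchAlgebra

variable {k : Type*} [Field k] {n : ℕ} {S : Type*} [Ring S] [Algebra k S]
  {L R : BoalchAlgebra k n →ₐ[k] S} {d : BoalchAlgebra k n →ₗ[k] S}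

theorem map_prefixContinuant_eq_zero (h : IsTwistedDerivation L R d)
    {e : FreeAlgebra k (BoalchGen n)} {w : ℕ → FreeAlgebra k (BoalchGen n)}
    (he : d (mk k n e) = 0) (hw : ∀ p, d (mk k n (w p)) = 0) (q : ℕ) :
    d (mk k n (prefixContinuant e w q)) = 0 := by
  induction q using Nat.twoStepInduction with
  | zero => exact he
  | one => simpa [prefixContinuant, eulerContinuant, eulerRev] using hw 0
  | more q h1 h2 =>
    rw [prefixContinuant_succ_succ, map_add, map_mul, map_add, h, h1, h2, hw, zero_mul, mul_zero,
      add_zero, add_zero]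

/-- A derivation that kills `f` and an element `Φ` of its corner also kills the inverse `φ` of `Φ`
in that corner. -/
theorem map_inverse_eq_zero (h : IsTwistedDerivation L R d) {f φ Φ : BoalchAlgebra k n}
    (hf : d f = 0) (hΦ : d Φ = 0) (h1 : φ * Φ = f) (h2 : Φ * φ = f) (h3 : φ * f = φ) :
    d φ = 0 := by
  have h4 : d φ * R Φ = 0 := by
    have := h φ Φ
    rwa [h1, hf, hΦ, mul_zero, add_zero, eq_comm] at this
  have h5 := h φ f
  rwa [h3, hf, mul_zero, add_zero, ← h2, map_mul, ← mul_assoc, h4, zero_mul] at h5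

/-- A derivation of the Boalch algebra is determined by its values on the idempotents and the
arrows. -/
theorem derivation_eq_zero (h : IsTwistedDerivation L R d) (h₁ : d (e₁ k n) = 0)
    (h₂ : d (e₂ k n) = 0) (ha : ∀ i, d (a k i) = 0) (hb : ∀ i, d (b k i) = 0)
    (z : BoalchAlgebra k n) : d z = 0 := by
  have hl : ∀ p, d (mk k n (letter k n p)) = 0 := by
    intro p
    rcases lt_or_ge p (2 * n) with hp | hp
    · obtain ⟨i, rfl⟩ | ⟨i, rfl⟩ := exists_letter_eq hp
      · rw [mk_letter_two_mul, ha]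
      · rw [mk_letter_two_mul_add_one, hb]
    · rw [letter_of_le hp, map_zero, map_zero]
  have hr : ∀ p, d (mk k n (revLetter k n p)) = 0 := by
    intro p
    rw [revLetter]
    split_ifs
    · exact hl _
    · rw [map_zero, map_zero]
  obtain ⟨w, rfl⟩ := mk_surjective z
  induction w using FreeAlgebra.induction with
  | grade0 c =>
    rw [Algebra.algebraMap_eq_smul_one, map_smul, map_one, map_smul, h.map_one, smul_zero]
  | grade1 x =>
    cases x with
    | e₁ => exact h₁
    | e₂ => exact h₂
    | a i => exact ha i
    | b i => exact hb i
    | invA =>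
      exact map_inverse_eq_zero h h₂
        (by rw [freeContA_eq]; exact map_prefixContinuant_eq_zero h h₂ hl _)
        contAInv_mul_mk mk_mul_contAInv contAInv_mul_e₂
    | invB =>
      exact map_inverse_eq_zero h h₁
        (by rw [freeContB_eq]; exact map_prefixContinuant_eq_zero h h₁ hr _)
        contBInv_mul_mk mk_mul_contBInv contBInv_mul_e₁
  | mul u v hu hv => rw [map_mul, h, hu, hv, zero_mul, mul_zero, add_zero]
  | add u v hu hv => rw [map_add, map_add, hu, hv, add_zero]

theorem map_e₁ (D : DoubleBracket k (idem k n)) (x : BoalchAlgebra k n) :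
    D.toFun x (e₁ k n) = 0 := D.map_idem x 0

theorem map_e₂ (D : DoubleBracket k (idem k n)) (x : BoalchAlgebra k n) :
    D.toFun x (e₂ k n) = 0 := D.map_idem x 1

/-- A double bracket on the Boalch algebra is determined by its values on the arrows. -/
theorem doubleBracket_ext {D D' : DoubleBracket k (idem k n)}
    (haa : ∀ i j, D.toFun (a k i) (a k j) = D'.toFun (a k i) (a k j))
    (hab : ∀ i j, D.toFun (a k i) (b k j) = D'.toFun (a k i) (b k j))
    (hbb : ∀ i j, D.toFun (b k i) (b k j) = D'.toFun (b k i) (b k j)) : D = D' := by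
  have hba : ∀ i j, D.toFun (b k i) (a k j) = D'.toFun (b k i) (a k j) := fun i j => by
    rw [D.antisymm, D'.antisymm, hab]
  have key : ∀ x, (∀ i, D.toFun x (a k i) = D'.toFun x (a k i)) →
      (∀ i, D.toFun x (b k i) = D'.toFun x (b k i)) → ∀ y, D.toFun x y = D'.toFun x y := by
    intro x h1 h2 y
    have := derivation_eq_zero ((D.isTwistedDerivation x).sub (D'.isTwistedDerivation x))
      (by rw [LinearMap.sub_apply, map_e₁, map_e₁, sub_zero])
      (by rw [LinearMap.sub_apply, map_e₂, map_e₂, sub_zero])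
      (fun i => by rw [LinearMap.sub_apply, h1, sub_self])
      (fun i => by rw [LinearMap.sub_apply, h2, sub_self]) y
    exact sub_eq_zero.1 this
  refine DoubleBracket.toFun_injective fun x => key x (fun i => ?_) fun i => ?_
  · rw [D.antisymm, D'.antisymm, key _ (haa i) (hab i)]
  · rw [D.antisymm, D'.antisymm, key _ (hba i) (hbb i)]

theorem isEulerBracket_unique {D D' : DoubleBracket k (idem k n)} (h : IsEulerBracket D)
    (h' : IsEulerBracket D') : D' = D := by
  refine doubleBracket_ext (fun i j => ?_) (fun i j => ?_) fun i j => ?_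
  · rcases lt_trichotomy i j with hij | rfl | hij
    · rw [h.aa_lt i j hij, h'.aa_lt i j hij]
    · rw [h.aa_eq, h'.aa_eq]
    · rw [h.aa_gt i j hij, h'.aa_gt i j hij]
  · rcases lt_trichotomy i j with hij | rfl | hij
    · rw [h.ab_lt i j hij, h'.ab_lt i j hij]
    · rw [h.ab_eq, h'.ab_eq]
    · rw [h.ab_gt i j hij, h'.ab_gt i j hij]
  · rcases lt_trichotomy i j with hij | rfl | hij
    · rw [h.bb_lt i j hij, h'.bb_lt i j hij]
    · rw [h.bb_eq, h'.bb_eq]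
    · rw [h.bb_gt i j hij, h'.bb_gt i j hij]

end BoalchAlgebra

/-! ### Triple brackets as derivations -/

section TripleBrackets

variable {k : Type*} [Field k] {A : Type*} [Ring A] [Algebra k A]

@[simp] theorem tau123_tmul (x y z : A) :
    tau123 k A ((x ⊗ₜ[k] y) ⊗ₜ[k] z) = (z ⊗ₜ[k] x) ⊗ₜ[k] y := by
  simp [tau123]

theorem induction_tmul₃ {p : (A ⊗[k] A) ⊗[k] A → Prop} (h0 : p 0)
    (ht : ∀ x y z, p ((x ⊗ₜ[k] y) ⊗ₜ[k] z)) (ha : ∀ s t, p s → p t → p (s + t)) (t) : p t := by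
  induction t using TensorProduct.induction_on with
  | zero => exact h0
  | tmul s z =>
    induction s using TensorProduct.induction_on with
    | zero => rw [TensorProduct.zero_tmul]; exact h0
    | tmul x y => exact ht x y z
    | add s t hs ht => rw [TensorProduct.add_tmul]; exact ha _ _ hs ht
  | add s t hs ht => exact ha _ _ hs ht

theorem tau123_tau123_tau123 (t : (A ⊗[k] A) ⊗[k] A) :
    tau123 k A (tau123 k A (tau123 k A t)) = t := by
  induction t using induction_tmul₃ with
  | h0 => simp only [map_zero]
  | ht x y z => simp only [tau123_tmul]
  | ha s t hs ht => rw [map_add, map_add, map_add, hs, ht]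

theorem tau123_mul (s t : (A ⊗[k] A) ⊗[k] A) :
    tau123 k A (s * t) = tau123 k A s * tau123 k A t := by
  induction s using induction_tmul₃ with
  | h0 => rw [zero_mul, map_zero, zero_mul]
  | ht x y z =>
    induction t using induction_tmul₃ with
    | h0 => rw [mul_zero, map_zero, mul_zero]
    | ht x' y' z' => simp only [tau123_tmul, Algebra.TensorProduct.tmul_mul_tmul]
    | ha s t hs ht => rw [mul_add, map_add, hs, ht, map_add, mul_add]
  | ha s t hs ht => rw [add_mul, map_add, hs, ht, map_add, add_mul]

theorem add_tmul₃ (s t : A ⊗[k] A) (z : A) : (s + t) ⊗ₜ[k] z = s ⊗ₜ[k] z + t ⊗ₜ[k] z :=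
  TensorProduct.add_tmul _ _ _

theorem neg_tmul₃ (s : A ⊗[k] A) (z : A) : (-s) ⊗ₜ[k] z = -(s ⊗ₜ[k] z) :=
  TensorProduct.neg_tmul _ _

theorem smul_tmul₃ (c : k) (s : A ⊗[k] A) (z : A) : (c • s) ⊗ₜ[k] z = c • (s ⊗ₜ[k] z) :=
  rfl

theorem zero_tmul₃ (z : A) : (0 : A ⊗[k] A) ⊗ₜ[k] z = 0 :=
  TensorProduct.zero_tmul _ _

/-- The left outer action of `A` on `A ⊗ A ⊗ A`. -/
def outerLeft₃ (k A : Type*) [Field k] [Ring A] [Algebra k A] : A →ₐ[k] (A ⊗[k] A) ⊗[k] A :=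
  (Algebra.TensorProduct.includeLeft (R := k) (S := k) (A := A ⊗[k] A) (B := A)).comp
    (Algebra.TensorProduct.includeLeft (R := k) (S := k) (A := A) (B := A))

/-- The right outer action of `A` on `A ⊗ A ⊗ A`. -/
def outerRight₃ (k A : Type*) [Field k] [Ring A] [Algebra k A] : A →ₐ[k] (A ⊗[k] A) ⊗[k] A :=
  Algebra.TensorProduct.includeRight

theorem outerLeft₃_apply (c : A) : outerLeft₃ k A c = (c ⊗ₜ[k] 1) ⊗ₜ[k] 1 := rfl

theorem outerRight₃_apply (c : A) : outerRight₃ k A c = (1 ⊗ₜ[k] 1) ⊗ₜ[k] c := rfl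

/-- The cancellation behind the derivation property of the triple bracket: of the terms `p` and `q`,
in which `c` and `d` enter different factors, only the sum `p + q = 0` occurs. -/
theorem add_cancel_cross {M : Type*} [AddCommGroup M] {x p y z q w u v : M} (h : p + q = 0) :
    x + (p + y) + (z + q + w) + (u + v) = x + z + u + (y + w + v) := by
  rw [eq_neg_of_add_eq_zero_left h]
  abel

namespace DoubleBracket

variable {I : Type*} {e : I → A} (D : DoubleBracket k e)

@[simp] theorem extL_tmul (x y z : A) : D.extL x (y ⊗ₜ[k] z) = D.toFun x y ⊗ₜ[k] z := by
  simp [extL]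

theorem leibniz_left (a b c : A) :
    D.toFun (a * b) c = D.toFun a c * (b ⊗ₜ[k] 1) + (1 ⊗ₜ[k] a) * D.toFun b c := by
  have hmul : ∀ s t : A ⊗[k] A, TensorProduct.comm k A A (s * t)
      = TensorProduct.comm k A A s * TensorProduct.comm k A A t :=
    fun s t => map_mul (Algebra.TensorProduct.comm k A A) s t
  rw [D.antisymm, D.leibniz, map_add, hmul, hmul, D.antisymm a c, D.antisymm b c]
  simp only [TensorProduct.comm_tmul, neg_mul, mul_neg]
  abel

theorem extL_add_left (a b : A) (t : A ⊗[k] A) : D.extL (a + b) t = D.extL a t + D.extL b t := by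
  rw [extL, map_add, LinearMap.rTensor_add]; rfl

theorem extL_smul_left (c : k) (a : A) (t : A ⊗[k] A) : D.extL (c • a) t = c • D.extL a t := by
  rw [extL, map_smul, LinearMap.rTensor_smul]; rfl

theorem extL_mul_right (a d : A) (t : A ⊗[k] A) :
    D.extL a (t * (1 ⊗ₜ[k] d)) = D.extL a t * ((1 ⊗ₜ[k] 1) ⊗ₜ[k] d) := by
  induction t using TensorProduct.induction_on with
  | zero => rw [zero_mul, map_zero, zero_mul]
  | tmul u v =>
    rw [Algebra.TensorProduct.tmul_mul_tmul, mul_one, extL_tmul, extL_tmul,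
      Algebra.TensorProduct.tmul_mul_tmul, ← Algebra.TensorProduct.one_def, mul_one]
  | add s t hs ht => rw [add_mul, map_add, hs, ht, map_add, add_mul]

theorem extL_mul_left (b c : A) (t : A ⊗[k] A) :
    D.extL b ((1 ⊗ₜ[k] c) * t) = ((1 ⊗ₜ[k] 1) ⊗ₜ[k] c) * D.extL b t := by
  induction t using TensorProduct.induction_on with
  | zero => rw [mul_zero, map_zero, mul_zero]
  | tmul u v =>
    rw [Algebra.TensorProduct.tmul_mul_tmul, one_mul, extL_tmul, extL_tmul,
      Algebra.TensorProduct.tmul_mul_tmul, ← Algebra.TensorProduct.one_def, one_mul]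
  | add s t hs ht => rw [mul_add, map_add, hs, ht, map_add, mul_add]

theorem extL_outer_left (a c : A) (t : A ⊗[k] A) :
    D.extL a ((c ⊗ₜ[k] 1) * t) =
      (D.toFun a c ⊗ₜ[k] 1) * (outerRight k A).toLinearMap.rTensor A t
        + ((c ⊗ₜ[k] 1) ⊗ₜ[k] 1) * D.extL a t := by
  induction t using TensorProduct.induction_on with
  | zero => simp only [mul_zero, map_zero, add_zero]
  | tmul u v =>
    rw [Algebra.TensorProduct.tmul_mul_tmul, one_mul, extL_tmul, extL_tmul, D.leibniz, add_tmul₃,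
      LinearMap.rTensor_tmul, Algebra.TensorProduct.tmul_mul_tmul,
      Algebra.TensorProduct.tmul_mul_tmul, one_mul]
    rfl
  | add s t hs ht =>
    rw [mul_add, map_add, hs, ht, map_add, map_add, mul_add, mul_add]
    abel

theorem extL_inner_right (b d : A) (t : A ⊗[k] A) :
    D.extL b (t * (d ⊗ₜ[k] 1)) =
      D.extL b t * ((1 ⊗ₜ[k] d) ⊗ₜ[k] 1)
        + (outerLeft k A).toLinearMap.rTensor A t * (D.toFun b d ⊗ₜ[k] 1) := by
  induction t using TensorProduct.induction_on with
  | zero => simp only [zero_mul, map_zero, add_zero]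
  | tmul u v =>
    rw [Algebra.TensorProduct.tmul_mul_tmul, mul_one, extL_tmul, extL_tmul, D.leibniz, add_tmul₃,
      LinearMap.rTensor_tmul, Algebra.TensorProduct.tmul_mul_tmul,
      Algebra.TensorProduct.tmul_mul_tmul, mul_one]
    rfl
  | add s t hs ht =>
    rw [add_mul, map_add, hs, ht, map_add, map_add, add_mul, add_mul]
    abel

theorem extL_mul (c d : A) (t : A ⊗[k] A) :
    D.extL (c * d) t =
      D.extL c t * ((d ⊗ₜ[k] 1) ⊗ₜ[k] 1) + ((1 ⊗ₜ[k] c) ⊗ₜ[k] 1) * D.extL d t := by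
  induction t using TensorProduct.induction_on with
  | zero => simp only [zero_mul, mul_zero, map_zero, add_zero]
  | tmul u v =>
    rw [extL_tmul, extL_tmul, extL_tmul, D.leibniz_left, add_tmul₃,
      Algebra.TensorProduct.tmul_mul_tmul, Algebra.TensorProduct.tmul_mul_tmul, mul_one, one_mul]
  | add s t hs ht =>
    rw [map_add, hs, ht, map_add, map_add, add_mul, mul_add]
    abel

theorem tau123_rTensor_includeLeft (t : A ⊗[k] A) :
    tau123 k A ((outerLeft k A).toLinearMap.rTensor A t) =
      TensorProduct.comm k A A t ⊗ₜ[k] 1 := by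
  induction t using TensorProduct.induction_on with
  | zero => rw [map_zero, map_zero, map_zero, zero_tmul₃]
  | tmul u v =>
    rw [LinearMap.rTensor_tmul]
    exact tau123_tmul _ _ _
  | add s t hs ht => rw [map_add, map_add, map_add, hs, ht, add_tmul₃]

theorem tau123_tmul_one (t : A ⊗[k] A) :
    tau123 k A (t ⊗ₜ[k] 1) = (outerRight k A).toLinearMap.rTensor A t := by
  induction t using TensorProduct.induction_on with
  | zero => rw [zero_tmul₃, map_zero, map_zero]
  | tmul u v =>
    rw [LinearMap.rTensor_tmul]
    exact tau123_tmul _ _ _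
  | add s t hs ht => rw [add_tmul₃, map_add, map_add, hs, ht]

/-- The triple bracket as a linear map in its last argument. -/
def tripleLin (a b : A) : A →ₗ[k] (A ⊗[k] A) ⊗[k] A where
  toFun := D.triple a b
  map_add' c d := by
    simp only [triple, map_add, LinearMap.add_apply, extL_add_left]
    abel
  map_smul' r c := by
    simp only [triple, map_smul, LinearMap.smul_apply, extL_smul_left, smul_add, RingHom.id_apply]

/-- The triple bracket of a double bracket is a derivation in its last argument. -/
theorem isTwistedDerivation_tripleLin (a b : A) :
    IsTwistedDerivation (outerLeft₃ k A) (outerRight₃ k A) (D.tripleLin a b) := by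
  intro c d
  change D.triple a b (c * d) = D.triple a b c * _ + _ * D.triple a b d
  have hcross : ∀ t, (D.toFun a c ⊗ₜ[k] (1 : A)) * t
      + (TensorProduct.comm k A A (D.toFun c a) ⊗ₜ[k] (1 : A)) * t = 0 := fun t => by
    rw [← add_mul, ← add_tmul₃, D.antisymm a c, neg_add_cancel, zero_tmul₃, zero_mul]
  have h1 : tau123 k A (D.extL b (D.toFun (c * d) a)) =
      tau123 k A (D.extL b (D.toFun c a)) * ((1 ⊗ₜ[k] 1) ⊗ₜ[k] d)
        + (TensorProduct.comm k A A (D.toFun c a) ⊗ₜ[k] (1 : A)) *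
          (outerRight k A).toLinearMap.rTensor A (D.toFun b d)
        + ((c ⊗ₜ[k] 1) ⊗ₜ[k] 1) * tau123 k A (D.extL b (D.toFun d a)) := by
    rw [D.leibniz_left, map_add, extL_inner_right, extL_mul_left, map_add, map_add, tau123_mul,
      tau123_mul, tau123_mul, tau123_rTensor_includeLeft, tau123_tmul_one (D.toFun b d),
      tau123_tmul, tau123_tmul]
  have h2 : tau123 k A (tau123 k A (D.extL (c * d) (D.toFun a b))) =
      tau123 k A (tau123 k A (D.extL c (D.toFun a b))) * ((1 ⊗ₜ[k] 1) ⊗ₜ[k] d)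
        + ((c ⊗ₜ[k] 1) ⊗ₜ[k] 1) * tau123 k A (tau123 k A (D.extL d (D.toFun a b))) := by
    rw [extL_mul, map_add, map_add, tau123_mul, tau123_mul, tau123_mul, tau123_mul]
    simp only [tau123_tmul]
  rw [triple, h1, h2, D.leibniz, map_add, extL_mul_right, extL_outer_left, outerLeft₃_apply,
    outerRight₃_apply, triple, triple, add_mul, add_mul, mul_add, mul_add]
  exact add_cancel_cross (hcross _)

theorem tau123_triple (a b c : A) : tau123 k A (D.triple b c a) = D.triple a b c := by
  rw [triple, triple, map_add, map_add, tau123_tau123_tau123]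
  abel

end DoubleBracket

/-- The element of `A ⊗ A ⊗ A` whose inner derivation, applied to `c`, is the contribution of the
idempotent `f` to `tripleQP`. -/
def gaugeElement (f a b : A) : (A ⊗[k] A) ⊗[k] A :=
  ((f * a) ⊗ₜ[k] (f * b)) ⊗ₜ[k] f - ((f * a) ⊗ₜ[k] f) ⊗ₜ[k] (b * f)
   - (f ⊗ₜ[k] (a * f * b)) ⊗ₜ[k] f + (f ⊗ₜ[k] (a * f)) ⊗ₜ[k] (b * f)

theorem mul_smul_sub_smul_mul {S : Type*} [Ring S] [Algebra k S] (c : k) (x y w : S) :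
    x * (c • w) - (c • w) * y = c • (x * w - w * y) := by
  rw [mul_smul_comm, smul_mul_assoc, smul_sub]

theorem inner_mul {S : Type*} [Ring S] (x y x' y' w : S) :
    x * x' * w - w * (y * y') = (x * w - w * y) * y' + x * (x' * w - w * y') := by
  noncomm_ring

variable {I : Type*} [Fintype I] (e : I → A)

/-- `tripleQP` is an inner derivation in its last argument. -/
theorem tripleQP_eq (a b c : A) :
    tripleQP k e a b c =
      outerLeft₃ k A c * ((1 / 4 : k) • ∑ s, gaugeElement (k := k) (e s) a b)
        - ((1 / 4 : k) • ∑ s, gaugeElement (k := k) (e s) a b) * outerRight₃ k A c := by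
  refine Eq.trans ?_ (mul_smul_sub_smul_mul (k := k) _ _ _ _).symm
  rw [tripleQP, Finset.mul_sum, Finset.sum_mul,
    ← Finset.sum_sub_distrib]
  congr 1
  refine Finset.sum_congr rfl fun s _ => ?_
  simp only [gaugeElement, outerLeft₃_apply, outerRight₃_apply, mul_add, mul_sub, add_mul, sub_mul,
    Algebra.TensorProduct.tmul_mul_tmul, one_mul, mul_one, ← mul_assoc]
  abel

/-- `tripleQP` as a linear map in its last argument. -/
def tripleQPLin (a b : A) : A →ₗ[k] (A ⊗[k] A) ⊗[k] A where
  toFun := tripleQP k e a b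
  map_add' c d := by
    simp only [tripleQP_eq, map_add, add_mul, mul_add]
    abel
  map_smul' r c := by
    simp only [tripleQP_eq, map_smul, smul_mul_assoc, mul_smul_comm, RingHom.id_apply]
    module

theorem isTwistedDerivation_tripleQPLin (a b : A) :
    IsTwistedDerivation (outerLeft₃ k A) (outerRight₃ k A) (tripleQPLin (k := k) e a b) := by
  intro c d
  change tripleQP k e a b (c * d) = tripleQP k e a b c * _ + _ * tripleQP k e a b d
  rw [tripleQP_eq, tripleQP_eq, tripleQP_eq, map_mul, map_mul]
  exact inner_mul _ _ _ _ _

theorem tau123_tripleQP (a b c : A) : tau123 k A (tripleQP k e b c a) = tripleQP k e a b c := by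
  rw [tripleQP, tripleQP, map_smul, map_sum]
  congr 1
  refine Finset.sum_congr rfl fun s _ => ?_
  simp only [map_sub, map_add, tau123_tmul]
  abel

end TripleBrackets

/-! ### Triple brackets of letters -/

section Letters

variable {k : Type*} [Field k] [CharZero k] {A : Type*} [Ring A] [Algebra k A]

/-- The contribution of an idempotent `f` to `4 • tripleQP`. -/
def gaugeBracket (k : Type*) [Field k] {A : Type*} [Ring A] [Algebra k A] (f a b c : A) :
    (A ⊗[k] A) ⊗[k] A :=
  ((c ⊗ₜ[k] 1) ⊗ₜ[k] 1) * gaugeElement f a b - gaugeElement f a b * ((1 ⊗ₜ[k] 1) ⊗ₜ[k] c)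

variable {I : Type*} {e : I → A} (D : DoubleBracket k e)

/-- The triple bracket of three parallel arrows `x, y, z`, which go from the vertex of `g` to that
of `f`. -/
theorem triple_parallel {f g x y z : A}
    (gf : g * f = 0) (fx : f * x = x) (xg : x * g = x) (fy : f * y = y) (yg : y * g = y)
    (fz : f * z = z) (zg : z * g = z) {ε₁ ε₂ ε₃ : k}
    (hxy : D.toFun x y = (ε₁ / 2) • (x ⊗ₜ[k] y + y ⊗ₜ[k] x))
    (hyz : D.toFun y z = (ε₂ / 2) • (y ⊗ₜ[k] z + z ⊗ₜ[k] y))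
    (hzx : D.toFun z x = (ε₃ / 2) • (z ⊗ₜ[k] x + x ⊗ₜ[k] z)) :
    D.triple x y z = (1 / 4 : k) • (gaugeBracket k f x y z + gaugeBracket k g x y z)
      + ((ε₁ * ε₂ + ε₂ * ε₃ + ε₃ * ε₁ + 1) / 4) •
        ((x ⊗ₜ[k] y) ⊗ₜ[k] z - (z ⊗ₜ[k] x) ⊗ₜ[k] y) := by
  have gx : g * x = 0 := by rw [← fx, ← mul_assoc, gf, zero_mul]
  have gy : g * y = 0 := by rw [← fy, ← mul_assoc, gf, zero_mul]
  have gz : g * z = 0 := by rw [← fz, ← mul_assoc, gf, zero_mul]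
  have xf : x * f = 0 := by rw [← xg, mul_assoc, gf, mul_zero]
  have yf : y * f = 0 := by rw [← yg, mul_assoc, gf, mul_zero]
  have xy : x * y = 0 := by rw [← xg, mul_assoc, gy, mul_zero]
  have zx : z * x = 0 := by rw [← zg, mul_assoc, gx, mul_zero]
  have yz : y * z = 0 := by rw [← yg, mul_assoc, gz, mul_zero]
  have hyx := D.antisymm y x
  have hzy := D.antisymm z y
  have hxz := D.antisymm x z
  rw [hxy] at hyx
  rw [hyz] at hzy
  rw [hzx] at hxz
  simp only [DoubleBracket.triple, hxy, hyz, hzx, hyx, hzy, hxz, map_smul, map_add, map_neg,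
    DoubleBracket.extL_tmul, tau123_tmul, TensorProduct.comm_tmul, add_tmul₃, neg_tmul₃,
    smul_tmul₃]
  simp only [gaugeBracket, gaugeElement, mul_add, mul_sub, add_mul, sub_mul,
    Algebra.TensorProduct.tmul_mul_tmul, fx, fy, fz, gx, gy, xf, yf, xg, yg, zg,
    mul_one, one_mul, mul_zero, TensorProduct.tmul_zero, TensorProduct.zero_tmul, xy, yz, zx,
    zero_mul]
  module

/-- The triple bracket of two parallel arrows `x, y` from the vertex of `g` to that of `f` and an
arrow `z` in the opposite direction. -/
theorem triple_opposite {f g x y z : A} (fg : f * g = 0)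
    (gf : g * f = 0) (fx : f * x = x) (xg : x * g = x) (fy : f * y = y) (yg : y * g = y)
    (gz : g * z = z) (zf : z * f = z) (Df : ∀ w, D.toFun w f = 0) (Dg : ∀ w, D.toFun w g = 0)
    {ε₁ ε₂ ε₃ δ₂ δ₃ : k} (hxy : D.toFun x y = (ε₁ / 2) • (x ⊗ₜ[k] y + y ⊗ₜ[k] x))
    (hyz : D.toFun y z =
      -(ε₂ / 2) • (g ⊗ₜ[k] (y * z) + (z * y) ⊗ₜ[k] f) + δ₂ • g ⊗ₜ[k] f)
    (hzx : D.toFun z x =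
      -(ε₃ / 2) • (f ⊗ₜ[k] (z * x) + (x * z) ⊗ₜ[k] g) + δ₃ • f ⊗ₜ[k] g) :
    D.triple x y z = (1 / 4 : k) • (gaugeBracket k f x y z + gaugeBracket k g x y z)
      + ((ε₁ * ε₂ + ε₂ * ε₃ + ε₃ * ε₁ + 1) / 4) •
        ((g ⊗ₜ[k] x) ⊗ₜ[k] (y * z) - ((z * x) ⊗ₜ[k] y) ⊗ₜ[k] f)
      + (δ₃ * (ε₁ + ε₂) / 2) • ((g ⊗ₜ[k] y) ⊗ₜ[k] f)
      - (δ₂ * (ε₃ + ε₁) / 2) • ((g ⊗ₜ[k] x) ⊗ₜ[k] f) := by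
  have gx : g * x = 0 := by rw [← fx, ← mul_assoc, gf, zero_mul]
  have gy : g * y = 0 := by rw [← fy, ← mul_assoc, gf, zero_mul]
  have fz : f * z = 0 := by rw [← gz, ← mul_assoc, fg, zero_mul]
  have xf : x * f = 0 := by rw [← xg, mul_assoc, gf, mul_zero]
  have yf : y * f = 0 := by rw [← yg, mul_assoc, gf, mul_zero]
  have zg : z * g = 0 := by rw [← zf, mul_assoc, fg, mul_zero]
  have xy : x * y = 0 := by rw [← xg, mul_assoc, gy, mul_zero]
  have hyx := D.antisymm y x
  have hzy := D.antisymm z y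
  have hxz := D.antisymm x z
  rw [hxy] at hyx
  rw [hyz] at hzy
  rw [hzx] at hxz
  simp only [DoubleBracket.triple, hxy, hyz, hzx, hyx, hzy, hxz, map_smul, map_add, map_neg,
    DoubleBracket.extL_tmul, tau123_tmul, TensorProduct.comm_tmul, add_tmul₃, neg_tmul₃,
    smul_tmul₃, D.leibniz, Df, Dg, TensorProduct.zero_tmul,
    mul_add, add_mul, neg_mul, smul_mul_assoc, mul_smul_comm,
    Algebra.TensorProduct.tmul_mul_tmul, ← mul_assoc, mul_one, one_mul, fy, xg,
    smul_zero, add_zero, zero_add]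
  simp only [gaugeBracket, gaugeElement, mul_add, mul_sub, add_mul, sub_mul,
    Algebra.TensorProduct.tmul_mul_tmul, fx, fy, fz, gx, gy, xf, yf, xg, yg,
    zg, mul_one, one_mul, zero_mul, mul_zero, TensorProduct.tmul_zero, TensorProduct.zero_tmul,
    xy]
  module

end Letters

/-! ### The quasi-Poisson property -/

section Signs

variable {k : Type*} [Field k]

theorem posSign_self (p : ℕ) : posSign k p p = 0 := by simp [posSign]

/-- The sum is `-1` for positions that are not all equal, and `0` otherwise. -/
theorem posSign_cyclic {p q r : ℕ} (h : ¬(p = q ∧ q = r)) :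
    posSign k p q * posSign k q r + posSign k q r * posSign k r p + posSign k r p * posSign k p q
      = -1 := by
  unfold posSign
  split_ifs <;> first | omega | ring

/-- If `r` is adjacent to `p`, then a position `q ≠ p` of the same parity as `p` lies on the same
side of `r` as of `p`. -/
theorem adjSign_mul_posSign {p q r : ℕ} (hpq : p ≠ q) (h : p % 2 = q % 2) (hr : r % 2 ≠ p % 2) :
    adjSign k r p * (posSign k p q + posSign k q r) = 0 := by
  unfold posSign adjSign
  split_ifs <;> first | omega | simp

theorem adjSign_mul_posSign' {p q r : ℕ} (hpq : p ≠ q) (h : p % 2 = q % 2) (hr : r % 2 ≠ p % 2) :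
    adjSign k q r * (posSign k r p + posSign k p q) = 0 := by
  unfold posSign adjSign
  split_ifs <;> first | omega | simp

end Signs

section Gauge

variable {k : Type*} [Field k] {A : Type*} [Ring A] [Algebra k A]

theorem gaugeBracket_self {f : A} (ff : f * f = f) (x y : A) : gaugeBracket k f x y f = 0 := by
  refine sub_eq_zero.2 ?_
  simp only [gaugeElement, mul_add, mul_sub, add_mul, sub_mul, Algebra.TensorProduct.tmul_mul_tmul,
    one_mul, mul_one, ← mul_assoc, ff]
  simp only [mul_assoc, ff]

theorem gaugeBracket_of_orthogonal {f g : A} (fg : f * g = 0) (gf : g * f = 0) (x y : A) :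
    gaugeBracket k f x y g = 0 := by
  refine sub_eq_zero.2 ?_
  simp only [gaugeElement, mul_add, mul_sub, add_mul, sub_mul, Algebra.TensorProduct.tmul_mul_tmul,
    one_mul, mul_one, ← mul_assoc, gf]
  simp only [mul_assoc, fg, zero_mul, mul_zero, TensorProduct.zero_tmul, TensorProduct.tmul_zero]

end Gauge

namespace BoalchAlgebra

variable {k : Type*} [Field k] {n : ℕ}

theorem mul_add_sub_add_mul {S : Type*} [Ring S] (x y v w : S) :
    x * (v + w) - (v + w) * y = x * v - v * y + (x * w - w * y) := by
  noncomm_ring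

theorem tripleQP_idem (x y z : BoalchAlgebra k n) :
    tripleQP k (idem k n) x y z = (1 / 4 : k) •
      (gaugeBracket k (e₁ k n) x y z + gaugeBracket k (e₂ k n) x y z) := by
  rw [tripleQP_eq]
  refine (mul_smul_sub_smul_mul (k := k) _ _ _ _).trans ?_
  rw [Fin.sum_univ_two]
  exact congrArg _ (mul_add_sub_add_mul _ _ _ _)

variable {D : DoubleBracket k (idem k n)}

theorem triple_rotate {x y z : BoalchAlgebra k n}
    (h : D.triple y z x = tripleQP k (idem k n) y z x) :
    D.triple x y z = tripleQP k (idem k n) x y z := by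
  rw [← D.tau123_triple, h, tau123_tripleQP]

theorem extL_idem (s : Fin 2) (t : BoalchAlgebra k n ⊗[k] BoalchAlgebra k n) :
    D.extL (idem k n s) t = 0 := by
  have h : ∀ x, D.toFun (idem k n s) x = 0 := fun x => by
    rw [D.antisymm, D.map_idem]
    exact (congrArg Neg.neg (map_zero _)).trans neg_zero
  induction t using TensorProduct.induction_on with
  | zero => exact map_zero _
  | tmul u v => rw [D.extL_tmul, h, zero_tmul₃]
  | add u v hu hv => rw [map_add, hu, hv, add_zero]

theorem triple_idem (x y : BoalchAlgebra k n) (s : Fin 2) :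
    D.triple x y (idem k n s) = tripleQP k (idem k n) x y (idem k n s) := by
  have h : D.toFun (idem k n s) x = 0 := by
    rw [D.antisymm, D.map_idem]
    exact (congrArg Neg.neg (map_zero _)).trans neg_zero
  have h1 : D.triple x y (idem k n s) = 0 := by
    rw [DoubleBracket.triple, extL_idem, h, D.map_idem]
    simp only [map_zero, add_zero]
  rw [h1, tripleQP_idem]
  fin_cases s
  · change 0 = (1 / 4 : k) • (gaugeBracket k (e₁ k n) x y (e₁ k n)
      + gaugeBracket k (e₂ k n) x y (e₁ k n))
    rw [gaugeBracket_self e₁_mul_e₁, gaugeBracket_of_orthogonal e₂_mul_e₁ e₁_mul_e₂, add_zero,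
      smul_zero]
  · change 0 = (1 / 4 : k) • (gaugeBracket k (e₁ k n) x y (e₂ k n)
      + gaugeBracket k (e₂ k n) x y (e₂ k n))
    rw [gaugeBracket_self e₂_mul_e₂, gaugeBracket_of_orthogonal e₁_mul_e₂ e₂_mul_e₁, add_zero,
      smul_zero]

/-- The triple bracket and `tripleQP` are derivations in the last argument, so that they agree as
soon as they agree on the arrows. -/
theorem triple_of_arrows {x y : BoalchAlgebra k n}
    (ha : ∀ i, D.triple x y (a k i) = tripleQP k (idem k n) x y (a k i))
    (hb : ∀ i, D.triple x y (b k i) = tripleQP k (idem k n) x y (b k i)) (z : BoalchAlgebra k n) :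
    D.triple x y z = tripleQP k (idem k n) x y z := by
  have hs : ∀ z, (D.tripleLin x y - tripleQPLin (k := k) (idem k n) x y) z
      = D.triple x y z - tripleQP k (idem k n) x y z := fun z => rfl
  have := derivation_eq_zero ((D.isTwistedDerivation_tripleLin x y).sub
    (isTwistedDerivation_tripleQPLin (idem k n) x y))
    ((hs _).trans (sub_eq_zero.2 (triple_idem x y 0)))
    ((hs _).trans (sub_eq_zero.2 (triple_idem x y 1)))
    (fun i => (hs _).trans (sub_eq_zero.2 (ha i))) (fun i => (hs _).trans (sub_eq_zero.2 (hb i))) z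
  exact sub_eq_zero.1 ((hs z).symm.trans this)

variable [CharZero k]

theorem triple_a_a_a (hD : ∀ x y, D.toFun (mk k n (gen k n x)) (mk k n (gen k n y))
      = genBracket k n x y) (i j l : Fin n) :
    D.triple (a k i) (a k j) (a k l) = tripleQP k (idem k n) (a k i) (a k j) (a k l) := by
  have haa : ∀ i j, D.toFun (a k i) (a k j) = _ := fun i j =>
    (hD (.a i) (.a j)).trans (letterBracket_a_a _ _ (by omega) i j)
  rw [triple_parallel D e₁_mul_e₂ (e₂_mul_a i) (a_mul_e₁ i)
    (e₂_mul_a j) (a_mul_e₁ j) (e₂_mul_a l) (a_mul_e₁ l) (haa i j) (haa j l) (haa l i),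
    tripleQP_idem, add_comm (gaugeBracket k (e₁ k n) _ _ _)]
  by_cases h : i = j ∧ j = l
  · obtain ⟨rfl, rfl⟩ := h
    simp
  · rw [posSign_cyclic (by rw [Fin.ext_iff, Fin.ext_iff] at h; omega)]
    simp

theorem triple_b_b_b (hD : ∀ x y, D.toFun (mk k n (gen k n x)) (mk k n (gen k n y))
      = genBracket k n x y) (i j l : Fin n) :
    D.triple (b k i) (b k j) (b k l) = tripleQP k (idem k n) (b k i) (b k j) (b k l) := by
  have hbb : ∀ i j, D.toFun (b k i) (b k j) = _ := fun i j =>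
    (hD (.b i) (.b j)).trans (letterBracket_b_b _ _ (by omega) i j)
  rw [triple_parallel D e₂_mul_e₁ (e₁_mul_b i) (b_mul_e₂ i)
    (e₁_mul_b j) (b_mul_e₂ j) (e₁_mul_b l) (b_mul_e₂ l) (hbb i j) (hbb j l) (hbb l i),
    tripleQP_idem]
  by_cases h : i = j ∧ j = l
  · obtain ⟨rfl, rfl⟩ := h
    simp
  · rw [posSign_cyclic (by rw [Fin.ext_iff, Fin.ext_iff] at h; omega)]
    simp

theorem triple_a_a_b (hD : ∀ x y, D.toFun (mk k n (gen k n x)) (mk k n (gen k n y))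
      = genBracket k n x y) (i j l : Fin n) :
    D.triple (a k i) (a k j) (b k l) = tripleQP k (idem k n) (a k i) (a k j) (b k l) := by
  rw [triple_opposite D e₂_mul_e₁ e₁_mul_e₂ (e₂_mul_a i) (a_mul_e₁ i)
    (e₂_mul_a j) (a_mul_e₁ j) (e₁_mul_b l) (b_mul_e₂ l) (map_e₂ D) (map_e₁ D)
    ((hD (.a i) (.a j)).trans (letterBracket_a_a _ _ (by omega) i j))
    ((hD (.a j) (.b l)).trans (letterBracket_a_b _ _ j l))
    ((hD (.b l) (.a i)).trans (letterBracket_b_a _ _ l i)),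
    tripleQP_idem, add_comm (gaugeBracket k (e₁ k n) _ _ _), posSign_cyclic (by omega)]
  by_cases h : i = j
  · obtain rfl := h
    rw [posSign_self, posSign_swap (2 * (i : ℕ)) (2 * l + 1),
      adjSign_swap (2 * (i : ℕ)) (2 * l + 1)]
    module
  · have h' : 2 * (i : ℕ) ≠ 2 * j := by rw [Fin.ext_iff] at h; omega
    rw [adjSign_mul_posSign h' (by omega) (by omega), adjSign_mul_posSign' h' (by omega) (by omega)]
    simp

theorem triple_b_b_a (hD : ∀ x y, D.toFun (mk k n (gen k n x)) (mk k n (gen k n y))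
      = genBracket k n x y) (i j l : Fin n) :
    D.triple (b k i) (b k j) (a k l) = tripleQP k (idem k n) (b k i) (b k j) (a k l) := by
  rw [triple_opposite D e₁_mul_e₂ e₂_mul_e₁ (e₁_mul_b i) (b_mul_e₂ i)
    (e₁_mul_b j) (b_mul_e₂ j) (e₂_mul_a l) (a_mul_e₁ l) (map_e₁ D) (map_e₂ D)
    ((hD (.b i) (.b j)).trans (letterBracket_b_b _ _ (by omega) i j))
    ((hD (.b j) (.a l)).trans (letterBracket_b_a _ _ j l))
    ((hD (.a l) (.b i)).trans (letterBracket_a_b _ _ l i)),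
    tripleQP_idem, posSign_cyclic (by omega)]
  by_cases h : i = j
  · obtain rfl := h
    rw [posSign_self, posSign_swap (2 * (i : ℕ) + 1) (2 * l),
      adjSign_swap (2 * (i : ℕ) + 1) (2 * l)]
    module
  · have h' : 2 * (i : ℕ) + 1 ≠ 2 * j + 1 := by rw [Fin.ext_iff] at h; omega
    rw [adjSign_mul_posSign h' (by omega) (by omega), adjSign_mul_posSign' h' (by omega) (by omega)]
    simp

/-- Each argument in turn is reduced to an arrow, after it has been rotated to the last place. -/
theorem isQuasiPoisson_of_genBracket (hD : ∀ x y,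
    D.toFun (mk k n (gen k n x)) (mk k n (gen k n y)) = genBracket k n x y) :
    D.IsQuasiPoisson := by
  have haa : ∀ i j z, D.triple (a k i) (a k j) z = tripleQP k (idem k n) (a k i) (a k j) z :=
    fun i j => triple_of_arrows (triple_a_a_a hD i j) (triple_a_a_b hD i j)
  have hbb : ∀ i j z, D.triple (b k i) (b k j) z = tripleQP k (idem k n) (b k i) (b k j) z :=
    fun i j => triple_of_arrows (triple_b_b_a hD i j) (triple_b_b_b hD i j)
  have hab : ∀ i j z, D.triple (a k i) (b k j) z = tripleQP k (idem k n) (a k i) (b k j) z :=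
    fun i j => triple_of_arrows (fun l => triple_rotate (triple_rotate (triple_a_a_b hD l i j)))
      (fun l => triple_rotate (triple_b_b_a hD j l i))
  have hba : ∀ i j z, D.triple (b k i) (a k j) z = tripleQP k (idem k n) (b k i) (a k j) z :=
    fun i j => triple_of_arrows (fun l => triple_rotate (triple_a_a_b hD j l i))
      (fun l => triple_rotate (triple_rotate (triple_b_b_a hD l i j)))
  have hza : ∀ x i z, D.triple x (a k i) z = tripleQP k (idem k n) x (a k i) z :=
    fun x i => triple_of_arrows (fun l => triple_rotate (haa i l x))
      (fun l => triple_rotate (hab i l x))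
  have hzb : ∀ x i z, D.triple x (b k i) z = tripleQP k (idem k n) x (b k i) z :=
    fun x i => triple_of_arrows (fun l => triple_rotate (hba i l x))
      (fun l => triple_rotate (hbb i l x))
  exact fun x y => triple_of_arrows (fun l => triple_rotate (hza y l x))
    (fun l => triple_rotate (hzb y l x))

end BoalchAlgebra

/-! ### Brackets on the zeroth Hochschild homology -/

section ZerothHochschildHomology

variable {k : Type*} [Field k] {A : Type*} [Ring A] [Algebra k A]

theorem toH0_mul_comm (x y : A) : toH0 k A (x * y) = toH0 k A (y * x) :=
  (Submodule.Quotient.eq _).2 (Submodule.subset_span ⟨(x, y), rfl⟩)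

theorem toH0_mul'_comm (t : A ⊗[k] A) :
    toH0 k A (LinearMap.mul' k A (TensorProduct.comm k A A t))
      = toH0 k A (LinearMap.mul' k A t) := by
  induction t using TensorProduct.induction_on with
  | zero => rw [map_zero]
  | tmul x y =>
    rw [TensorProduct.comm_tmul, LinearMap.mul'_apply, LinearMap.mul'_apply, toH0_mul_comm]
  | add s t hs ht => rw [map_add, map_add, map_add, hs, ht, map_add, map_add]

/-- The product `a ⊗ b ⊗ c ↦ a b c`. -/
def mul₃ (k A : Type*) [Field k] [Ring A] [Algebra k A] : (A ⊗[k] A) ⊗[k] A →ₗ[k] A :=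
  LinearMap.mul' k A ∘ₗ (LinearMap.mul' k A).rTensor A

theorem mul₃_tmul (t : A ⊗[k] A) (z : A) :
    mul₃ k A (t ⊗ₜ[k] z) = LinearMap.mul' k A t * z := by
  simp [mul₃]

theorem toH0_mul₃_tau123 (t : (A ⊗[k] A) ⊗[k] A) :
    toH0 k A (mul₃ k A (tau123 k A t)) = toH0 k A (mul₃ k A t) := by
  induction t using induction_tmul₃ with
  | h0 => rw [map_zero]
  | ht x y z =>
    rw [tau123_tmul, mul₃_tmul, mul₃_tmul, LinearMap.mul'_apply, LinearMap.mul'_apply, mul_assoc,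
      toH0_mul_comm]
  | ha s t hs ht => rw [map_add, map_add, map_add, hs, ht, map_add, map_add]

theorem mul₃_tripleQP {I : Type*} [Fintype I] (e : I → A) (a b c : A) :
    mul₃ k A (tripleQP k e a b c) = 0 := by
  rw [tripleQP, map_smul, map_sum, Finset.sum_eq_zero, smul_zero]
  intro s _
  simp only [map_sub, map_add, mul₃_tmul, LinearMap.mul'_apply]
  noncomm_ring

variable {F : Type*} [Ring F] [Algebra k F]

/-- The map `H₀(A) → H₀(F)` induced by a homomorphism `A → F`. -/
def mapH0 (π : A →ₐ[k] F) : H0 k A →ₗ[k] H0 k F :=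
  Submodule.mapQ _ _ π.toLinearMap <| by
    rw [commutatorSubspace, Submodule.span_le]
    rintro _ ⟨⟨x, y⟩, rfl⟩
    refine Submodule.subset_span ⟨(π x, π y), ?_⟩
    simp

theorem mapH0_toH0 (π : A →ₐ[k] F) (x : A) : mapH0 π (toH0 k A x) = toH0 k F (π x) := rfl

/-- Along a surjection, every element of the span of the commutators lifts to such an element. -/
theorem exists_toH0_eq_zero {π : A →ₐ[k] F} (hπ : Function.Surjective π) {z : F}
    (hz : toH0 k F z = 0) : ∃ c : A, toH0 k A c = 0 ∧ π c = z := by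
  rw [Submodule.mkQ_apply, Submodule.Quotient.mk_eq_zero] at hz
  induction hz using Submodule.span_induction with
  | mem z hz =>
    obtain ⟨⟨x, y⟩, rfl⟩ := hz
    obtain ⟨u, rfl⟩ := hπ x
    obtain ⟨v, rfl⟩ := hπ y
    exact ⟨u * v - v * u, by rw [map_sub, toH0_mul_comm, sub_self], by simp⟩
  | zero => exact ⟨0, map_zero _, map_zero _⟩
  | add x y _ _ hx hy =>
    obtain ⟨c, hc, rfl⟩ := hx
    obtain ⟨c', hc', rfl⟩ := hy
    exact ⟨c + c', by rw [map_add, hc, hc', add_zero], map_add _ _ _⟩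
  | smul r x _ hx =>
    obtain ⟨c, hc, rfl⟩ := hx
    exact ⟨r • c, by rw [map_smul, hc, smul_zero], map_smul _ _ _⟩

theorem H0PoissonStructure.ext_bracket {P P' : H0PoissonStructure k A}
    (h : ∀ x y, P.bracket (toH0 k A x) (toH0 k A y) = P'.bracket (toH0 k A x) (toH0 k A y)) :
    P = P' := by
  obtain ⟨f, _, _, _⟩ := P
  obtain ⟨g, _, _, _⟩ := P'
  obtain rfl : f = g := by
    ext x y
    exact h x y
  rfl

namespace DoubleBracket

variable {I : Type*} {e : I → A} (D : DoubleBracket k e)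

/-- The associated bracket as a bilinear map. -/
def assocLin : A →ₗ[k] A →ₗ[k] A := D.toFun.compr₂ (LinearMap.mul' k A)

theorem assocLin_apply (a b : A) : D.assocLin a b = D.assocBracket a b := rfl

theorem mul'_outer (t : A ⊗[k] A) (c : A) :
    LinearMap.mul' k A (t * (1 ⊗ₜ[k] c)) = LinearMap.mul' k A t * c ∧
      LinearMap.mul' k A ((c ⊗ₜ[k] 1) * t) = c * LinearMap.mul' k A t := by
  induction t using TensorProduct.induction_on with
  | zero => exact ⟨by rw [zero_mul, map_zero, zero_mul], by rw [mul_zero, map_zero, mul_zero]⟩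
  | tmul x y => simp [mul_assoc]
  | add s t hs ht =>
    exact ⟨by rw [add_mul, map_add, hs.1, ht.1, map_add, add_mul],
      by rw [mul_add, map_add, hs.2, ht.2, map_add, mul_add]⟩

theorem assocBracket_mul (a b c : A) :
    D.assocBracket a (b * c) = D.assocBracket a b * c + b * D.assocBracket a c := by
  rw [assocBracket, D.leibniz, map_add, (mul'_outer _ _).1, (mul'_outer _ _).2]
  rfl

theorem isTwistedDerivation_comp_assocLin (π : A →ₐ[k] F) (a : A) :
    IsTwistedDerivation π π (π.toLinearMap ∘ₗ D.assocLin a) := by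
  intro b c
  change π (D.assocBracket a (b * c)) = π (D.assocBracket a b) * π c + π b * π (D.assocBracket a c)
  rw [assocBracket_mul, map_add, map_mul, map_mul]

theorem toH0_assocBracket_antisymm (a b : A) :
    toH0 k A (D.assocBracket a b) = -toH0 k A (D.assocBracket b a) := by
  have h := congrArg (fun t => toH0 k A (LinearMap.mul' k A t)) (D.antisymm a b)
  refine h.trans ?_
  change toH0 k A (LinearMap.mul' k A (-_)) = _
  rw [map_neg, map_neg, toH0_mul'_comm]
  rfl

/-- A derivation preserves the span of the commutators. -/
theorem toH0_assocBracket_eq_zero (a : A) {c : A} (hc : toH0 k A c = 0) :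
    toH0 k A (D.assocBracket a c) = 0 := by
  rw [Submodule.mkQ_apply, Submodule.Quotient.mk_eq_zero] at hc
  have key : commutatorSubspace k A ≤ LinearMap.ker (toH0 k A ∘ₗ D.assocLin a) := by
    refine Submodule.span_le.2 ?_
    rintro _ ⟨⟨x, y⟩, rfl⟩
    change toH0 k A (D.assocLin a (x * y - y * x)) = 0
    rw [map_sub, assocLin_apply, assocLin_apply, assocBracket_mul, assocBracket_mul, map_sub,
      map_add, map_add, toH0_mul_comm x, toH0_mul_comm y]
    abel
  exact key hc

/-- Modulo commutators, `{a, x y}` is the sum of the products of `⦃a, x ⊗ y⦄_L` and of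
`⦃a, y ⊗ x⦄_L`. -/
theorem toH0_assocBracket_mul' (a : A) (t : A ⊗[k] A) :
    toH0 k A (D.assocLin a (LinearMap.mul' k A t)) =
      toH0 k A (mul₃ k A (D.extL a t))
        + toH0 k A (mul₃ k A (D.extL a (TensorProduct.comm k A A t))) := by
  induction t using TensorProduct.induction_on with
  | zero => simp only [map_zero, add_zero]
  | tmul x y =>
    rw [TensorProduct.comm_tmul, extL_tmul, extL_tmul, mul₃_tmul, mul₃_tmul, LinearMap.mul'_apply,
      assocLin_apply, assocBracket_mul, map_add, toH0_mul_comm x]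
    rfl
  | add s t hs ht => simp only [map_add, hs, ht]; abel

theorem toH0_assocBracket_assocBracket (a b c : A) :
    toH0 k A (D.assocBracket a (D.assocBracket b c)) =
      toH0 k A (mul₃ k A (D.extL a (D.toFun b c)))
        - toH0 k A (mul₃ k A (D.extL a (D.toFun c b))) := by
  have h : TensorProduct.comm k A A (D.toFun b c) = -D.toFun c b := by
    rw [D.antisymm c b]
    exact (neg_neg _).symm
  refine (D.toH0_assocBracket_mul' a _).trans ?_
  rw [h, sub_eq_add_neg, ← map_neg (toH0 k A), ← map_neg (mul₃ k A)]
  exact congrArg _ (congrArg _ (congrArg _ (map_neg (D.extL a) (D.toFun c b))))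

theorem toH0_mul₃_triple (a b c : A) :
    toH0 k A (mul₃ k A (D.triple a b c)) =
      toH0 k A (mul₃ k A (D.extL a (D.toFun b c)))
        + toH0 k A (mul₃ k A (D.extL b (D.toFun c a)))
        + toH0 k A (mul₃ k A (D.extL c (D.toFun a b))) := by
  rw [triple, map_add, map_add, map_add, map_add, toH0_mul₃_tau123, toH0_mul₃_tau123,
    toH0_mul₃_tau123]

variable {D}

/-- The Jacobiator of the associated bracket is, modulo commutators, a difference of two products
of triple brackets, and the product of `tripleQP` vanishes. -/
theorem IsQuasiPoisson.jacobi [Fintype I] (h : D.IsQuasiPoisson) (a b c : A) :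
    toH0 k A (D.assocBracket a (D.assocBracket b c))
      + toH0 k A (D.assocBracket b (D.assocBracket c a))
      + toH0 k A (D.assocBracket c (D.assocBracket a b)) = 0 := by
  have h1 : ∀ a b c, toH0 k A (mul₃ k A (D.triple a b c)) = 0 := fun a b c => by
    rw [h a b c, mul₃_tripleQP, map_zero]
  have h2 := h1 a b c
  have h3 := h1 a c b
  rw [toH0_mul₃_triple] at h2 h3
  rw [toH0_assocBracket_assocBracket, toH0_assocBracket_assocBracket,
    toH0_assocBracket_assocBracket, ← sub_eq_zero.2 (h2.trans h3.symm)]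
  abel

theorem toH0_map_assocBracket_eq_zero {π : A →ₐ[k] F} (hπ : Function.Surjective π)
    (h : ∀ x y, π y = 0 → π (D.assocBracket x y) = 0) (x : A) {y : A}
    (hy : toH0 k F (π y) = 0) : toH0 k F (π (D.assocBracket x y)) = 0 := by
  obtain ⟨c, hc, hcy⟩ := exists_toH0_eq_zero hπ hy
  have h1 : π (D.assocBracket x (y - c)) = 0 := h _ _ (by rw [map_sub, hcy, sub_self])
  rw [← assocLin_apply, map_sub, map_sub, sub_eq_zero] at h1
  rw [← assocLin_apply, h1, ← mapH0_toH0, assocLin_apply, D.toH0_assocBracket_eq_zero x hc,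
    map_zero]

/-- The associated bracket of a quasi-Poisson double bracket descends to an `H₀`-Poisson structure
on every quotient by an ideal that is stable under the derivations `{x, -}`. -/
theorem IsQuasiPoisson.existsUnique_H0PoissonStructure [Fintype I] [CharZero k]
    (hD : D.IsQuasiPoisson) {π : A →ₐ[k] F} (hπ : Function.Surjective π)
    (h : ∀ x y, π y = 0 → π (D.assocBracket x y) = 0) :
    ∃! P : H0PoissonStructure k F, ∀ x y,
      P.bracket (toH0 k F (π x)) (toH0 k F (π y)) = toH0 k F (π (D.assocBracket x y)) := by
  -- The bracket on `H₀(F)` is computed on lifts, chosen by linear sections `s` and `σ`.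
  let p : A →ₗ[k] H0 k F := toH0 k F ∘ₗ π.toLinearMap
  have hp : Function.Surjective p := (Submodule.mkQ_surjective _).comp hπ
  obtain ⟨s, hs⟩ := LinearMap.exists_rightInverse_of_surjective p (LinearMap.range_eq_top.2 hp)
  have hps : ∀ u, p (s u) = u := fun u => LinearMap.congr_fun hs u
  obtain ⟨σ, hσ⟩ := LinearMap.exists_rightInverse_of_surjective π.toLinearMap
    (LinearMap.range_eq_top.2 hπ)
  have hπσ : ∀ u, π (σ u) = u := fun u => LinearMap.congr_fun hσ u
  have hright : ∀ x y y', p y = p y' → p (D.assocLin x y) = p (D.assocLin x y') := by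
    intro x y y' hy
    rw [← sub_eq_zero, ← map_sub] at hy ⊢
    rw [← map_sub]
    exact toH0_map_assocBracket_eq_zero hπ h x hy
  have hanti : ∀ x y, p (D.assocLin x y) = -p (D.assocLin y x) := fun x y => by
    have := congrArg (mapH0 π) (D.toH0_assocBracket_antisymm x y)
    rwa [map_neg] at this
  have hboth : ∀ x x' y y', p x = p x' → p y = p y' →
      p (D.assocLin x y) = p (D.assocLin x' y') := by
    intro x x' y y' hx hy
    rw [hright x y y' hy, hanti, hright y' x x' hx, ← hanti]
  let β : H0 k F →ₗ[k] H0 k F →ₗ[k] H0 k F := (D.assocLin.compr₂ p).compl₁₂ s s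
  have hβ : ∀ x y, β (p x) (p y) = p (D.assocLin x y) := fun x y =>
    hboth _ _ _ _ (hps _) (hps _)
  refine ⟨⟨β, fun u => ?_, fun u v w => ?_, fun u => ?_⟩, hβ, fun P hP => ?_⟩
  · obtain ⟨x, rfl⟩ := hp u
    rw [hβ]
    have h2 : (2 : k) • p (D.assocLin x x) = 0 := by
      rw [two_smul, ← sub_neg_eq_add, ← hanti, sub_self]
    exact (smul_eq_zero.1 h2).resolve_left two_ne_zero
  · obtain ⟨x, rfl⟩ := hp u
    obtain ⟨y, rfl⟩ := hp v
    obtain ⟨z, rfl⟩ := hp w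
    rw [hβ, hβ, hβ, hβ, hβ, hβ]
    have := congrArg (mapH0 π) (hD.jacobi x y z)
    rwa [map_add, map_add, map_zero] at this
  · obtain ⟨x, rfl⟩ := hp u
    have hd : ∀ y y', π y = π y' → π (D.assocLin x y) = π (D.assocLin x y') := by
      intro y y' hy
      rw [← sub_eq_zero, ← map_sub] at hy ⊢
      rw [← map_sub]
      exact h _ _ hy
    refine ⟨π.toLinearMap ∘ₗ D.assocLin x ∘ₗ σ, fun f g => ?_, fun f => ?_⟩
    · change π (D.assocLin x (σ (f * g)))
        = π (D.assocLin x (σ f)) * g + f * π (D.assocLin x (σ g))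
      rw [hd _ (σ f * σ g) (by rw [map_mul π, hπσ, hπσ, hπσ]), assocLin_apply, assocBracket_mul,
        map_add, map_mul, map_mul, hπσ, hπσ]
      rfl
    · obtain ⟨y, rfl⟩ := hπ f
      refine (hβ x y).trans ?_
      exact congrArg (toH0 k F) (hd _ _ (hπσ _).symm)
  · refine H0PoissonStructure.ext_bracket fun f g => ?_
    obtain ⟨x, rfl⟩ := hπ f
    obtain ⟨y, rfl⟩ := hπ g
    exact (hP x y).trans (hβ x y).symm

end DoubleBracket

end ZerothHochschildHomology

/-! ### Descent to the fission algebra -/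

theorem map_eulerRev {R S G : Type*} [Semiring R] [Semiring S] [FunLike G R S]
    [RingHomClass G R S] (f : G) (e : R) (l : List R) :
    f (eulerRev e l) = eulerRev (f e) (l.map f) := by
  induction l using eulerRev.induct with
  | case1 => rfl
  | case2 y => rfl
  | case3 y z l h1 h2 => simp only [eulerRev, List.map_cons, map_add, map_mul, h1, h2]

theorem mul'_momentBracket {k : Type*} [Field k] {A : Type*} [Ring A] [Algebra k A] (f φ x : A) :
    LinearMap.mul' k A (momentBracket f φ x) = 0 := by
  simp only [momentBracket, map_smul, map_sub, map_add, LinearMap.mul'_apply, mul_assoc]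
  rw [sub_self, zero_add, sub_self, smul_zero]

namespace BoalchAlgebra

variable {k : Type*} [Field k] {n : ℕ}

theorem contA_eq : contA k n = mk k n (freeContA k n) := by
  rw [contA, freeContA, eulerContinuant, eulerContinuant, map_eulerRev, List.map_reverse]
  congr 2
  rw [alternatingWord, alternatingWord, List.map_flatMap]
  rfl

variable {D : DoubleBracket k (idem k n)}

theorem assocBracket_contAInv (hD : ∀ x z, D.toFun (mk k n (gen k n x)) (mk k n z)
      = outerDerivation (mk k n) (genBracket k n x) z) (x : BoalchAlgebra k n) :
    D.assocBracket x (contAInv k n) = 0 := by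
  obtain ⟨w, rfl⟩ := mk_surjective x
  have h : D.toFun (contAInv k n) (mk k n w) = TensorProduct.comm k _ _
        (momentBracket (e₂ k n) (contAInv k n) (mk k n w)) :=
    (hD .invA w).trans (outerDerivation_invA w)
  rw [DoubleBracket.assocBracket, D.antisymm, h, comm_comm, map_neg, mul'_momentBracket, neg_zero]

theorem assocBracket_contBInv (hD : ∀ x z, D.toFun (mk k n (gen k n x)) (mk k n z)
      = outerDerivation (mk k n) (genBracket k n x) z) (x : BoalchAlgebra k n) :
    D.assocBracket x (contBInv k n) = 0 := by
  obtain ⟨w, rfl⟩ := mk_surjective x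
  have h : D.toFun (contBInv k n) (mk k n w) = -TensorProduct.comm k _ _
        (momentBracket (e₁ k n) (contBInv k n) (mk k n w)) :=
    (hD .invB w).trans (outerDerivation_invB w)
  have h1 : D.toFun (mk k n w) (contBInv k n)
      = momentBracket (e₁ k n) (contBInv k n) (mk k n w) := by
    rw [D.antisymm, h, map_neg, comm_comm]
    exact neg_neg _
  rw [DoubleBracket.assocBracket, h1, mul'_momentBracket]

theorem assocBracket_contA (hD : ∀ x z, D.toFun (mk k n (gen k n x)) (mk k n z)
      = outerDerivation (mk k n) (genBracket k n x) z) (x : BoalchAlgebra k n) :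
    D.assocBracket x (contA k n) = 0 := by
  rw [contA_eq]
  have h₂ : D.assocBracket x (e₂ k n) = 0 := by
    rw [DoubleBracket.assocBracket, map_e₂, map_zero]
  exact map_inverse_eq_zero
    (D.isTwistedDerivation_comp_assocLin (AlgHom.id k (BoalchAlgebra k n)) x)
    h₂ (assocBracket_contAInv hD x) mk_mul_contAInv contAInv_mul_mk mk_freeContA_mul_e₂

/-- The derivations `{x, -}` kill both components of the moment map, so they preserve the ideal
that defines the fission algebra. -/
theorem proj_assocBracket_eq_zero (hD : ∀ x z, D.toFun (mk k n (gen k n x)) (mk k n z)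
      = outerDerivation (mk k n) (genBracket k n x) z) {q₁ q₂ : k} (x y : BoalchAlgebra k n)
    (hy : FissionAlgebra.proj k n q₁ q₂ y = 0) :
    FissionAlgebra.proj k n q₁ q₂ (D.assocBracket x y) = 0 := by
  have hrel : ∀ u v, FissionRel k n q₁ q₂ u v →
      FissionAlgebra.proj k n q₁ q₂ u = FissionAlgebra.proj k n q₁ q₂ v :=
    fun u v h => RingQuot.mkAlgHom_rel k h
  refine (D.isTwistedDerivation_comp_assocLin (FissionAlgebra.proj k n q₁ q₂)
    x).eq_zero_of_mkAlgHom hrel hrel ?_ hy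
  have h₁ : D.assocLin x (e₁ k n) = 0 := by
    rw [D.assocLin_apply, DoubleBracket.assocBracket, map_e₁, map_zero]
  have h₂ : D.assocLin x (e₂ k n) = 0 := by
    rw [D.assocLin_apply, DoubleBracket.assocBracket, map_e₂, map_zero]
  rintro _ _ (_ | _)
  · rw [LinearMap.comp_apply, LinearMap.comp_apply, map_smul (D.assocLin x), h₁, smul_zero,
      D.assocLin_apply, assocBracket_contBInv hD]
  · rw [LinearMap.comp_apply, LinearMap.comp_apply, map_smul (D.assocLin x), h₂, smul_zero,
      D.assocLin_apply, assocBracket_contA hD]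

end BoalchAlgebra

end NCPoisson

theorem corollary3p3 {k : Type*} [Field k] [CharZero k] (n : ℕ) (hn : 1 ≤ n)
    (q₁ q₂ : k) (hq₁ : q₁ ≠ 0) (hq₂ : q₂ ≠ 0) :
    ∃ D : NCPoisson.DoubleBracket k (NCPoisson.BoalchAlgebra.idem k n),
      NCPoisson.IsEulerBracket D ∧
      (∀ D' : NCPoisson.DoubleBracket k (NCPoisson.BoalchAlgebra.idem k n),
        NCPoisson.IsEulerBracket D' → D' = D) ∧
      D.IsQuasiPoisson ∧
      ∃! P : NCPoisson.H0PoissonStructure k (NCPoisson.FissionAlgebra k n q₁ q₂),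
        ∀ x y : NCPoisson.BoalchAlgebra k n,
          P.bracket
              (NCPoisson.toH0 k _ (NCPoisson.FissionAlgebra.proj k n q₁ q₂ x))
              (NCPoisson.toH0 k _ (NCPoisson.FissionAlgebra.proj k n q₁ q₂ y)) =
            NCPoisson.toH0 k _ (NCPoisson.FissionAlgebra.proj k n q₁ q₂ (D.assocBracket x y)) := by
  obtain ⟨D, hD⟩ := NCPoisson.BoalchAlgebra.exists_doubleBracket_genBracket (k := k) (n := n)
  have hgen := fun x y => (hD x (NCPoisson.gen k n y)).trans (NCPoisson.outerDerivation_ι _ _ _)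
  have hE := NCPoisson.BoalchAlgebra.isEulerBracket_of_genBracket hgen
  have hQ := NCPoisson.BoalchAlgebra.isQuasiPoisson_of_genBracket hgen
  exact ⟨D, hE, fun D' hD' => NCPoisson.BoalchAlgebra.isEulerBracket_unique hE hD', hQ,
    hQ.existsUnique_H0PoissonStructure (RingQuot.mkAlgHom_surjective _ _)
      (NCPoisson.BoalchAlgebra.proj_assocBracket_eq_zero hD)⟩
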